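/- Let $K$ be a commutative ring, let $U$ and $T$ be dg-$K$-algebras (that is, $\mathbb{Z}$-graded unital associative $K$-algebras with a $K$-linear differential $d$ of degree $+1$, $d^2=0$, satisfying $d(ab)=d(a)b+(-1)^{|a|}a\,d(b)$) and let $N$ be a dg $U$-$T$-bimodule (a left dg $U$-module and right dg $T$-module with commuting actions on which the two $K$-actions agree; $d(um)=d(u)m+(-1)^{|u|}u\,d(m)$ and $d(mt)=d(m)t+(-1)^{|m|}m\,d(t)$). For a dg-$K$-algebra $A$ let $\mathrm{DgMod}(A)$ be the dg-category of left dg $A$-modules, with $\mathrm{Hom}_A(M,M')=\bigoplus_{n\in\mathbb{Z}}\mathrm{Hom}^n_A(M,M')$, where $\mathrm{Hom}^n_A(M,M')$ consists of the $K$-linear maps $g$ such that $g(M^i)\subseteq M'^{\,i+n}$ for all $i$ and $a\,g(x)=(-1)^{n|a|}g(ax)$ for homogeneous $a\in A$ and all $x\in M$, with differential $d(g)=d_{M'}\circ g-(-1)^{|g|}g\circ d_M$. Let $\mathbb{G}=\mathrm{Hom}_U(N,-):\mathrm{DgMod}(U)\to\mathrm{DgMod}(T)$ be the dg-functor that sends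 $B$ to the dg-$K$-module $\mathrm{Hom}_U(N,B)$ with $T$-action $(t\eta)(m)=(-1)^{|t|(|\eta|+|m|)}\eta(mt)$ for homogeneous $t,\eta,m$, and sends a morphism $\beta$ to $\eta\mapsto\beta\circ\eta$. Let $(\mathrm{DgMod}(T),\mathbb{G}\,\mathrm{DgMod}(U))$ be the dg-comma category: its objects are the triples $(A,f,B)$ with $A\in\mathrm{DgMod}(T)$, $B\in\mathrm{DgMod}(U)$ and $f\in\mathrm{Hom}_T^0(A,\mathbb{G}(B))$ with $d(f)=0$; its morphisms $(A,f,B)\to(A',f',B')$ are the pairs $(\alpha,\beta)$ of morphisms $\alpha:A\to A'$, $\beta:B\to B'$ with $f'\circ\alpha=\mathbb{G}(\beta)\circ f$, where $(\alpha,\beta)$ has degree $n$ if $\alpha$ and $\beta$ both have degree $n$, and $d(\alpha,\beta)=(d\alpha,d\beta)$. Then the set $\Lambda=\left[\begin{smallmatrix}T&0\\N&U\end{smallmatrix}\right]$ of matrices $\left[\begin{smallmatrix}t&0\\m&u\end{smallmatrix}\right]$ with $t\in T$, $m\in N$, $u\in U$, with entrywise $K$-module structure, grading and differential, unit $\left[\begin{smallmatrix}1&0\\0&1\end{smallmatrix}\right]$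 and multiplication $$\left[\begin{smallmatrix}t_2&0\\m_2&u_2\end{smallmatrix}\right]\left[\begin{smallmatrix}t_1&0\\m_1&u_1\end{smallmatrix}\right]=\left[\begin{smallmatrix}t_2t_1&0\\m_2t_1+u_2m_1&u_2u_1\end{smallmatrix}\right],$$ is a dg-$K$-algebra, and there is an equivalence of dg-categories $$(\mathrm{DgMod}(T),\mathbb{G}\,\mathrm{DgMod}(U))\simeq\mathrm{DgMod}(\Lambda),$$ that is, there are $K$-linear functors in both directions that preserve degrees and commute with the differentials, and natural isomorphisms, whose components are closed of degree $0$, between their composites and the identity functors. -/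

import Mathlib

set_option linter.unusedVariables false

open CategoryTheory

universe w u u₁ u₂ v v₁ v₂

noncomputable section

/-! ### Graded modules -/

section Graded

variable {K : Type w} [CommRing K] {X : Type v} [AddCommGroup X] [Module K X]

@[elab_as_elim]
theorem gradedInduction {gr : ℤ → Submodule K X} (h : DirectSum.IsInternal gr)
    {P : X → Prop} (x : X) (hom : ∀ n, ∀ x ∈ gr n, P x) (add : ∀ x y, P x → P y → P (x + y)) :
    P x := by
  have hx : x ∈ ⨆ n, gr n := by rw [h.submodule_iSup_eq_top]; trivial
  exact Submodule.iSup_induction gr (motive := P) hx hom (hom 0 0 (zero_mem _)) add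

theorem gradedExt {Y : Type v₁} [AddCommGroup Y] [Module K Y]
    {gr : ℤ → Submodule K X} (h : DirectSum.IsInternal gr)
    {f g : X →ₗ[K] Y} (hfg : ∀ n, ∀ x ∈ gr n, f x = g x) : f = g := by
  ext x
  exact gradedInduction h x hfg fun x y hx hy => by simp [hx, hy]

/-- The linear map out of a graded module `X` that is given by `φ n` on the degree `n` part. -/
def gradedLift {Y : Type v₁} [AddCommGroup Y] [Module K Y]
    {gr : ℤ → Submodule K X} (h : DirectSum.IsInternal gr) (φ : ℤ → X →ₗ[K] Y) : X →ₗ[K] Y :=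
  DirectSum.toModule K ℤ Y (fun n => (φ n).domRestrict (gr n)) ∘ₗ
    (LinearEquiv.ofBijective (DirectSum.coeLinearMap gr) h).symm.toLinearMap

theorem gradedLift_of_mem {Y : Type v₁} [AddCommGroup Y] [Module K Y]
    {gr : ℤ → Submodule K X} (h : DirectSum.IsInternal gr) (φ : ℤ → X →ₗ[K] Y)
    {n : ℤ} {x : X} (hx : x ∈ gr n) : gradedLift h φ x = φ n x := by
  have : (LinearEquiv.ofBijective (DirectSum.coeLinearMap gr) h).symm x =
      DirectSum.lof K ℤ (fun n => gr n) n ⟨x, hx⟩ := by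
    rw [LinearEquiv.symm_apply_eq]
    exact (DirectSum.coeLinearMap_lof gr n ⟨x, hx⟩).symm
  rw [gradedLift, LinearMap.comp_apply, LinearEquiv.coe_coe, this, DirectSum.toModule_lof]
  rfl

/-- The projection of a graded module onto its degree `n` part. -/
def gradedProj {gr : ℤ → Submodule K X} (h : DirectSum.IsInternal gr) (n : ℤ) : X →ₗ[K] X :=
  gradedLift h fun m => if m = n then LinearMap.id else 0

theorem gradedProj_of_mem {gr : ℤ → Submodule K X} (h : DirectSum.IsInternal gr) (n : ℤ)
    {m : ℤ} {x : X} (hx : x ∈ gr m) : gradedProj h n x = if m = n then x else 0 := by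
  rw [gradedProj, gradedLift_of_mem h _ hx]
  split_ifs <;> rfl

theorem gradedProj_mem {gr : ℤ → Submodule K X} (h : DirectSum.IsInternal gr) (n : ℤ) (x : X) :
    gradedProj h n x ∈ gr n := by
  refine gradedInduction h x (fun m x hx => ?_) (fun x y hx hy => ?_)
  · rw [gradedProj_of_mem h n hx]
    split_ifs with hm
    · exact hm ▸ hx
    · exact zero_mem _
  · rw [map_add]
    exact add_mem hx hy

theorem sum_gradedProj {gr : ℤ → Submodule K X} (h : DirectSum.IsInternal gr) (x : X) :
    ∃ s₀ : Finset ℤ, ∀ s, s₀ ⊆ s → ∑ n ∈ s, gradedProj h n x = x := by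
  refine gradedInduction h x (fun m x hx => ⟨{m}, fun s hs => ?_⟩) (fun x y hx hy => ?_)
  · simp only [gradedProj_of_mem h _ hx]
    rw [Finset.sum_ite_eq, if_pos (hs (Finset.mem_singleton_self m))]
  · obtain ⟨s₁, h₁⟩ := hx
    obtain ⟨s₂, h₂⟩ := hy
    refine ⟨s₁ ∪ s₂, fun s hs => ?_⟩
    simp only [map_add, Finset.sum_add_distrib]
    rw [h₁ s (Finset.union_subset_left hs), h₂ s (Finset.union_subset_right hs)]

/-- A submodule that is spanned by homogeneous elements is graded. -/
theorem isInternal_comap {gr : ℤ → Submodule K X} (h : iSupIndep gr) (q : Submodule K X)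
    (hq : q ≤ ⨆ n, gr n ⊓ q) : DirectSum.IsInternal fun n => (gr n).comap q.subtype := by
  rw [DirectSum.isInternal_submodule_iff_iSupIndep_and_iSup_eq_top]
  constructor
  · intro n
    rw [Submodule.disjoint_def]
    rintro x hx hx'
    have := h n
    rw [Submodule.disjoint_def] at this
    refine Subtype.ext (this x.1 hx ?_)
    have hle : (⨆ m, ⨆ (_ : m ≠ n), (gr m).comap q.subtype) ≤
        (⨆ m, ⨆ (_ : m ≠ n), gr m).comap q.subtype :=
      iSup₂_le fun m hm y hy => (le_iSup₂_of_le (f := fun m (_ : m ≠ n) => gr m) m hm le_rfl) hy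
    exact hle hx'
  · rw [eq_top_iff]
    rintro x -
    have hle : (⨆ n, gr n ⊓ q) ≤ (⨆ n, (gr n).comap q.subtype).map q.subtype :=
      iSup_le fun n y hy => ⟨⟨y, hy.2⟩, (le_iSup (fun n => (gr n).comap q.subtype) n) hy.1, rfl⟩
    obtain ⟨y, hy, hyx⟩ := hle (hq x.2)
    rwa [← Subtype.ext (a1 := y) (a2 := x) hyx]

/-- The Koszul sign operator `x ↦ (-1) ^ (i * |x|) x` of a graded module. -/
def koszulSign {gr : ℤ → Submodule K X} (h : DirectSum.IsInternal gr) (i : ℤ) : X →ₗ[K] X :=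
  gradedLift h fun n => (i * n).negOnePow • LinearMap.id

theorem koszulSign_of_mem {gr : ℤ → Submodule K X} (h : DirectSum.IsInternal gr) (i : ℤ)
    {n : ℤ} {x : X} (hx : x ∈ gr n) : koszulSign h i x = (i * n).negOnePow • x := by
  rw [koszulSign, gradedLift_of_mem h _ hx]
  rfl

theorem negOnePow_smul_mem (p : Submodule K X) (n : ℤ) {x : X} (hx : x ∈ p) :
    n.negOnePow • x ∈ p := by
  rw [Units.smul_def]
  exact zsmul_mem hx _

theorem map_negOnePow_smul {Y : Type v₁} [AddCommGroup Y] [Module K Y] (f : X →ₗ[K] Y)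
    (n : ℤ) (x : X) : f (n.negOnePow • x) = n.negOnePow • f x := by
  rw [Units.smul_def, Units.smul_def, map_zsmul]

end Graded

/-! ### Dg-algebras, dg-modules, dg-bimodules -/

/-- A dg-`K`-algebra: a `ℤ`-graded associative unital `K`-algebra with a differential of
degree `1` that satisfies the graded Leibniz rule. -/
structure DGAlg (K : Type w) [CommRing K] : Type (max w (u + 1)) where
  carrier : Type u
  [ring : Ring carrier]
  [algebra : Algebra K carrier]
  gr : ℤ → Submodule K carrier
  [gradedMonoid : SetLike.GradedMonoid gr]
  isInternal : DirectSum.IsInternal gr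
  d : carrier →ₗ[K] carrier
  d_mem : ∀ {n : ℤ} {a : carrier}, a ∈ gr n → d a ∈ gr (n + 1)
  d_d : ∀ a, d (d a) = 0
  d_mul : ∀ {n : ℤ} {a : carrier}, a ∈ gr n → ∀ b : carrier,
    d (a * b) = d a * b + n.negOnePow • (a * d b)

instance (K : Type w) [CommRing K] : CoeSort (DGAlg.{w, u} K) (Type u) := ⟨DGAlg.carrier⟩

attribute [instance] DGAlg.ring DGAlg.algebra DGAlg.gradedMonoid

/-- A dg-`K`-module. -/
structure DGKMod (K : Type w) [CommRing K] : Type (max w (v + 1)) where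
  carrier : Type v
  [addCommGroup : AddCommGroup carrier]
  [moduleK : Module K carrier]
  gr : ℤ → Submodule K carrier
  isInternal : DirectSum.IsInternal gr
  d : carrier →ₗ[K] carrier
  d_mem : ∀ {n : ℤ} {x : carrier}, x ∈ gr n → d x ∈ gr (n + 1)
  d_d : ∀ x, d (d x) = 0

instance (K : Type w) [CommRing K] : CoeSort (DGKMod.{w, v} K) (Type v) := ⟨DGKMod.carrier⟩

attribute [instance] DGKMod.addCommGroup DGKMod.moduleK

/-- A left dg-module over the dg-`K`-algebra `A`. -/
structure DGMod {K : Type w} [CommRing K] (A : DGAlg.{w, u} K) : Type (max w u (v + 1))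
    extends DGKMod.{w, v} K where
  [module : Module A carrier]
  [isScalarTower : IsScalarTower K A carrier]
  smul_mem : ∀ {i j : ℤ} {a : A} {x : carrier}, a ∈ A.gr i → x ∈ gr j → a • x ∈ gr (i + j)
  d_smul : ∀ {i : ℤ} {a : A}, a ∈ A.gr i → ∀ x : carrier,
    d (a • x) = A.d a • x + i.negOnePow • (a • d x)

instance {K : Type w} [CommRing K] (A : DGAlg.{w, u} K) :
    CoeSort (DGMod.{w, u, v} A) (Type v) := ⟨fun M => M.carrier⟩

attribute [instance] DGMod.module DGMod.isScalarTower

/-- A dg-`U`-`T`-bimodule `N`: a left dg-`U`-module with a compatible structure of right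
dg-`T`-module, on which the two actions of `K` agree. The product `x t` is written
`MulOpposite.op t • x`. -/
structure DGBimod {K : Type w} [CommRing K] (U : DGAlg.{w, u₂} K) (T : DGAlg.{w, u₁} K) :
    Type (max w u₁ u₂ (v + 1)) extends DGMod.{w, u₂, v} U where
  [rightModule : Module (T.carrier)ᵐᵒᵖ carrier]
  [rightIsScalarTower : IsScalarTower K (T.carrier)ᵐᵒᵖ carrier]
  [smulCommClass : SMulCommClass U (T.carrier)ᵐᵒᵖ carrier]
  rsmul_mem : ∀ {i j : ℤ} {x : carrier} {t : T}, x ∈ gr i → t ∈ T.gr j →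
    MulOpposite.op t • x ∈ gr (i + j)
  d_rsmul : ∀ {i : ℤ} {x : carrier}, x ∈ gr i → ∀ t : T,
    d (MulOpposite.op t • x) =
      MulOpposite.op t • d x + i.negOnePow • (MulOpposite.op (T.d t) • x)

instance {K : Type w} [CommRing K] (U : DGAlg.{w, u₂} K) (T : DGAlg.{w, u₁} K) :
    CoeSort (DGBimod.{w, u₁, u₂, v} U T) (Type v) := ⟨fun M => M.carrier⟩

attribute [instance] DGBimod.rightModule DGBimod.rightIsScalarTower DGBimod.smulCommClass

/-! ### The dg-`K`-module of morphisms between two dg-modules -/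

namespace DGMod

variable {K : Type w} [CommRing K] {A : DGAlg.{w, u} K}

theorem negOnePow_smul_comm (M : DGMod.{w, u, v} A) (n : ℤ) (a : A) (x : M) :
    a • (n.negOnePow • x) = n.negOnePow • (a • x) := by
  rw [Units.smul_def, Units.smul_def, smul_comm]

theorem smul_comm_K (M : DGMod.{w, u, v} A) (k : K) (a : A) (x : M) :
    a • (k • x) = k • (a • x) := by
  rw [algebra_compatible_smul A k x, algebra_compatible_smul A k (a • x), smul_smul, smul_smul,
    Algebra.commutes]

/-- `Hom^n(M, N)`: the `K`-linear maps `f` with `f (M^i) ⊆ N^(i+n)` and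
`a f(x) = (-1) ^ (n |a|) f(a x)`. -/
def homDeg (M N : DGMod.{w, u, v} A) (n : ℤ) : Submodule K (M →ₗ[K] N) where
  carrier := {f | (∀ i, ∀ x ∈ M.gr i, f x ∈ N.gr (i + n)) ∧
    ∀ i, ∀ a ∈ A.gr i, ∀ x : M, a • f x = (n * i).negOnePow • f (a • x)}
  zero_mem' := by simp
  add_mem' := fun {f g} hf hg =>
    ⟨fun i x hx => add_mem (hf.1 i x hx) (hg.1 i x hx), fun i a ha x => by
      simp [smul_add, hf.2 i a ha, hg.2 i a ha]⟩
  smul_mem' := fun k f hf =>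
    ⟨fun i x hx => Submodule.smul_mem _ k (hf.1 i x hx), fun i a ha x => by
      simp only [LinearMap.smul_apply]
      rw [smul_comm_K, hf.2 i a ha, Units.smul_def, Units.smul_def, smul_comm]⟩

/-- `Hom(M, N)`, the sum of all `Hom^n(M, N)` inside the `K`-linear maps. The sum is direct by
`DGMod.homGr_isInternal`. -/
def homTotal (M N : DGMod.{w, u, v} A) : Submodule K (M →ₗ[K] N) := ⨆ n, homDeg M N n

/-- The degree `n` part of `Hom(M, N)`. -/
def homGr (M N : DGMod.{w, u, v} A) (n : ℤ) : Submodule K (homTotal M N) :=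
  (homDeg M N n).comap (homTotal M N).subtype

theorem homDeg_le (M N : DGMod.{w, u, v} A) (n : ℤ) : homDeg M N n ≤ homTotal M N :=
  le_iSup (homDeg M N) n

theorem homDeg_iSupIndep (M N : DGMod.{w, u, v} A) : iSupIndep (homDeg M N) := by
  intro n
  rw [Submodule.disjoint_def]
  intro f hf hf'
  refine gradedExt M.isInternal fun i x hx => ?_
  have h1 : f x ∈ N.gr (i + n) := hf.1 i x hx
  have h2 : f x ∈ ⨆ m, ⨆ (_ : m ≠ i + n), N.gr m := by
    have : (⨆ m, ⨆ (_ : m ≠ n), homDeg M N m) ≤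
        (⨆ m, ⨆ (_ : m ≠ i + n), N.gr m).comap (LinearMap.applyₗ x) := by
      refine iSup₂_le fun m hm g hg => ?_
      exact (le_iSup₂_of_le (f := fun m (_ : m ≠ i + n) => N.gr m) (i + m)
        (fun h => hm (by omega)) le_rfl) (hg.1 i x hx)
    exact this hf'
  have := N.isInternal.submodule_iSupIndep (i + n)
  rw [Submodule.disjoint_def] at this
  exact this _ h1 h2

theorem homGr_isInternal (M N : DGMod.{w, u, v} A) : DirectSum.IsInternal (homGr M N) := by
  refine isInternal_comap (homDeg_iSupIndep M N) _ ?_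
  exact iSup_mono fun n => le_inf le_rfl (homDeg_le M N n)

@[elab_as_elim]
theorem homGr_induction {M N : DGMod.{w, u, v} A} {P : homTotal M N → Prop} (f : homTotal M N)
    (hom : ∀ n, ∀ f : homTotal M N, f.1 ∈ homDeg M N n → P f)
    (add : ∀ f g, P f → P g → P (f + g)) : P f :=
  gradedInduction (homGr_isInternal M N) f hom add

theorem d_comp_d (M : DGMod.{w, u, v} A) : M.d ∘ₗ M.d = 0 := LinearMap.ext M.d_d

/-- The value of `f ↦ d_N ∘ f - (-1) ^ |f| f ∘ d_M` as a `K`-linear map. -/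
def homDAux (M N : DGMod.{w, u, v} A) : homTotal M N →ₗ[K] (M →ₗ[K] N) where
  toFun f := N.d ∘ₗ f.1 - (koszulSign (homGr_isInternal M N) 1 f).1 ∘ₗ M.d
  map_add' f g := by
    ext x
    simp
    abel
  map_smul' k f := by
    ext x
    simp [smul_sub]

theorem homDAux_of_mem {M N : DGMod.{w, u, v} A} {n : ℤ} (f : homTotal M N)
    (hf : f.1 ∈ homDeg M N n) :
    homDAux M N f = N.d ∘ₗ f.1 - n.negOnePow • (f.1 ∘ₗ M.d) := by
  have := koszulSign_of_mem (homGr_isInternal M N) 1 (x := f) (n := n) hf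
  rw [one_mul] at this
  change N.d ∘ₗ f.1 - (koszulSign (homGr_isInternal M N) 1 f).1 ∘ₗ M.d = _
  rw [this]
  congr 1

theorem homDAux_mem {M N : DGMod.{w, u, v} A} {n : ℤ} (f : homTotal M N)
    (hf : f.1 ∈ homDeg M N n) : homDAux M N f ∈ homDeg M N (n + 1) := by
  rw [homDAux_of_mem f hf]
  constructor
  · intro i x hx
    rw [← add_assoc]
    refine sub_mem (N.d_mem (hf.1 i x hx)) (negOnePow_smul_mem _ _ ?_)
    have := hf.1 _ _ (M.d_mem hx)
    rwa [show i + 1 + n = i + n + 1 by ring] at this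
  · intro i a ha x
    simp only [LinearMap.sub_apply, LinearMap.comp_apply, LinearMap.smul_apply]
    have h1 := N.d_smul ha (f.1 x)
    have h4 := hf.2 _ _ (A.d_mem ha) x
    rw [mul_add, mul_one, Int.negOnePow_add] at h4
    rw [hf.2 i a ha x, h4, map_negOnePow_smul] at h1
    rw [smul_sub, negOnePow_smul_comm, hf.2 i a ha (M.d x), M.d_smul ha, map_add,
      map_negOnePow_smul, add_mul, one_mul, Int.negOnePow_add]
    generalize (n * i).negOnePow = c at *
    generalize n.negOnePow = b at *
    generalize i.negOnePow = e at *
    have h5 : a • N.d (f.1 x) = e • (c • N.d (f.1 (a • x)) - (c * b) • f.1 (A.d a • x)) := by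
      rw [h1, add_sub_cancel_left, smul_smul, Int.units_mul_self, one_smul]
    rw [h5]
    rcases Int.units_eq_one_or e with rfl | rfl <;> rcases Int.units_eq_one_or b with rfl | rfl <;>
      rcases Int.units_eq_one_or c with rfl | rfl <;> simp <;> abel

theorem homDAux_mem_homTotal {M N : DGMod.{w, u, v} A} (f : homTotal M N) :
    homDAux M N f ∈ homTotal M N :=
  homGr_induction f (fun n f hf => homDeg_le M N _ (homDAux_mem f hf)) fun f g hf hg => by
    rw [map_add]
    exact add_mem hf hg

/-- The differential `f ↦ d_N ∘ f - (-1) ^ |f| f ∘ d_M` of `Hom(M, N)`. -/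
def homD (M N : DGMod.{w, u, v} A) : homTotal M N →ₗ[K] homTotal M N :=
  (homDAux M N).codRestrict _ homDAux_mem_homTotal

theorem homD_of_mem {M N : DGMod.{w, u, v} A} {n : ℤ} (f : homTotal M N)
    (hf : f.1 ∈ homDeg M N n) :
    (homD M N f).1 = N.d ∘ₗ f.1 - n.negOnePow • (f.1 ∘ₗ M.d) :=
  homDAux_of_mem f hf

/-- The dg-`K`-module `Hom(M, N)`. -/
@[reducible] def homDG (M N : DGMod.{w, u, v} A) : DGKMod.{w, v} K where
  carrier := homTotal M N
  gr := homGr M N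
  isInternal := homGr_isInternal M N
  d := homD M N
  d_mem := fun {n f} hf => homDAux_mem f hf
  d_d := fun f => homGr_induction f (fun n f hf => by
      ext x
      rw [homD_of_mem _ (homDAux_mem f hf), homD_of_mem f hf]
      simp [N.d_d, M.d_d, Int.negOnePow_succ])
    fun f g hf hg => by rw [map_add, map_add, hf, hg, add_zero]


@[simp] theorem homTotal_add_apply {M N : DGMod.{w, u, v} A} (f g : homTotal M N) (x : M) :
    (f + g).1 x = f.1 x + g.1 x := rfl

theorem homTotal_ext {M N : DGMod.{w, u, v} A} {f g : homTotal M N} (h : ∀ x, f.1 x = g.1 x) :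
    f = g := Subtype.ext (LinearMap.ext h)

theorem comp_mem_homDeg {L M N : DGMod.{w, u, v} A} {m n : ℤ} {f : L →ₗ[K] M} {g : M →ₗ[K] N}
    (hf : f ∈ homDeg L M m) (hg : g ∈ homDeg M N n) : g ∘ₗ f ∈ homDeg L N (m + n) := by
  constructor
  · intro i x hx
    rw [← add_assoc]
    exact hg.1 _ _ (hf.1 i x hx)
  · intro i a ha x
    simp only [LinearMap.comp_apply]
    rw [hg.2 i a ha, hf.2 i a ha, map_negOnePow_smul, smul_smul, add_mul, Int.negOnePow_add,
      mul_comm]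

theorem comp_mem_homTotal {L M N : DGMod.{w, u, v} A} (f : homTotal L M) (g : homTotal M N) :
    g.1 ∘ₗ f.1 ∈ homTotal L N := by
  refine homGr_induction f (fun m f hf => ?_) (fun f f' hf hf' => ?_)
  · refine homGr_induction g (fun n g hg => ?_) (fun g g' hg hg' => ?_)
    · exact homDeg_le _ _ _ (comp_mem_homDeg hf hg)
    · change (g.1 + g'.1) ∘ₗ f.1 ∈ homTotal L N
      rw [LinearMap.add_comp]
      exact add_mem hg hg'
  · change g.1 ∘ₗ (f.1 + f'.1) ∈ homTotal L N
    rw [LinearMap.comp_add]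
    exact add_mem hf hf'

theorem id_mem_homDeg (M : DGMod.{w, u, v} A) : LinearMap.id ∈ homDeg M M 0 :=
  ⟨fun i x hx => by simpa using hx, fun i a _ x => by simp⟩

/-- The category `DgMod(A)`: the objects are the left dg-`A`-modules, the morphisms from `M` to
`N` are the elements of the dg-`K`-module `Hom(M, N)`. -/
instance : Category.{v} (DGMod.{w, u, v} A) where
  Hom M N := homDG M N
  id M := ⟨LinearMap.id, homDeg_le M M 0 (id_mem_homDeg M)⟩
  comp f g := ⟨g.1 ∘ₗ f.1, comp_mem_homTotal f g⟩

theorem id_def (M : DGMod.{w, u, v} A) (x : M) : (𝟙 M : M ⟶ M).1 x = x := rfl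

theorem comp_def {L M N : DGMod.{w, u, v} A} (f : L ⟶ M) (g : M ⟶ N) (x : L) :
    (f ≫ g).1 x = g.1 (f.1 x) := rfl

instance : Preadditive (DGMod.{w, u, v} A) where
  homGroup M N := inferInstanceAs (AddCommGroup (homDG M N))
  add_comp L M N f f' g := homTotal_ext fun x => map_add g.1 _ _
  comp_add L M N f g g' := rfl

instance : Linear K (DGMod.{w, u, v} A) where
  homModule M N := inferInstanceAs (Module K (homDG M N))
  smul_comp L M N k f g := homTotal_ext fun x => map_smul g.1 _ _
  comp_smul L M N f k g := rfl

end DGMod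

/-! ### Dg-categories and dg-functors -/

/-- A dg-category over `K`: a `K`-linear category whose morphism modules are dg-`K`-modules, such
that composition is of degree zero and commutes with the differentials, that is,
`d (g ∘ f) = d g ∘ f + (-1) ^ |g| g ∘ d f`. Here `f ≫ g` is `g ∘ f`. -/
class DGCategory (K : Type w) [CommRing K] (C : Type u) [Category.{v} C] [Preadditive C]
    [Linear K C] where
  gr (X Y : C) : ℤ → Submodule K (X ⟶ Y)
  isInternal (X Y : C) : DirectSum.IsInternal (gr X Y)
  d (X Y : C) : (X ⟶ Y) →ₗ[K] (X ⟶ Y)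
  d_mem : ∀ {X Y : C} {n : ℤ} {f : X ⟶ Y}, f ∈ gr X Y n → d X Y f ∈ gr X Y (n + 1)
  d_d : ∀ {X Y : C} (f : X ⟶ Y), d X Y (d X Y f) = 0
  comp_mem : ∀ {X Y Z : C} {m n : ℤ} {f : X ⟶ Y} {g : Y ⟶ Z}, f ∈ gr X Y m → g ∈ gr Y Z n →
    f ≫ g ∈ gr X Z (m + n)
  d_comp : ∀ {X Y Z : C} {m n : ℤ} {f : X ⟶ Y} {g : Y ⟶ Z}, f ∈ gr X Y m → g ∈ gr Y Z n →
    d X Z (f ≫ g) = f ≫ d Y Z g + n.negOnePow • (d X Y f ≫ g)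

/-- A closed morphism of degree zero. -/
def DGCategory.IsClosedZero (K : Type w) [CommRing K] {C : Type u} [Category.{v} C]
    [Preadditive C] [Linear K C] [DGCategory K C] {X Y : C} (f : X ⟶ Y) : Prop :=
  f ∈ gr (K := K) X Y 0 ∧ d (K := K) X Y f = 0

/-- A functor between dg-categories is a dg-functor if it is `K`-linear, preserves degrees and
commutes with the differentials. -/
class IsDGFunctor (K : Type w) [CommRing K]
    {C : Type u₁} [Category.{v₁} C] [Preadditive C] [Linear K C] [DGCategory K C]
    {D : Type u₂} [Category.{v₂} D] [Preadditive D] [Linear K D] [DGCategory K D]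
    (F : C ⥤ D) : Prop where
  map_add : ∀ {X Y : C} (f g : X ⟶ Y), F.map (f + g) = F.map f + F.map g
  map_smul : ∀ {X Y : C} (k : K) (f : X ⟶ Y), F.map (k • f) = k • F.map f
  map_mem : ∀ {X Y : C} {n : ℤ} {f : X ⟶ Y}, f ∈ DGCategory.gr (K := K) X Y n →
    F.map f ∈ DGCategory.gr (K := K) (F.obj X) (F.obj Y) n
  map_d : ∀ {X Y : C} (f : X ⟶ Y), F.map (DGCategory.d (K := K) X Y f) =
    DGCategory.d (K := K) (F.obj X) (F.obj Y) (F.map f)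

/-- An equivalence of dg-categories: an equivalence of categories given by mutually quasi-inverse
dg-functors, whose unit and counit are closed of degree zero. -/
structure DGEquivalence (K : Type w) [CommRing K]
    (C : Type u₁) [Category.{v₁} C] [Preadditive C] [Linear K C] [DGCategory K C]
    (D : Type u₂) [Category.{v₂} D] [Preadditive D] [Linear K D] [DGCategory K D] where
  toEquivalence : C ≌ D
  functor_dg : IsDGFunctor K toEquivalence.functor
  inverse_dg : IsDGFunctor K toEquivalence.inverse
  unit_closed : ∀ X : C, DGCategory.IsClosedZero K (toEquivalence.unitIso.hom.app X)
  counit_closed : ∀ Y : D, DGCategory.IsClosedZero K (toEquivalence.counitIso.hom.app Y)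

namespace DGMod

variable {K : Type w} [CommRing K] {A : DGAlg.{w, u} K}

instance : DGCategory K (DGMod.{w, u, v} A) where
  gr M N := (homDG M N).gr
  isInternal M N := (homDG M N).isInternal
  d M N := (homDG M N).d
  d_mem := fun {M N _ _} hf => (homDG M N).d_mem hf
  d_d := fun {M N} f => (homDG M N).d_d f
  comp_mem := fun hf hg => comp_mem_homDeg hf hg
  d_comp := fun {L M N m n f g} hf hg => by
    refine homTotal_ext fun x => ?_
    have h1 := LinearMap.congr_fun (homD_of_mem f hf) x
    have h2 := LinearMap.congr_fun (homD_of_mem g hg) (f.1 x)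
    have h3 := LinearMap.congr_fun (homD_of_mem (f ≫ g) (comp_mem_homDeg hf hg)) x
    change (homD L N (f ≫ g)).1 x =
      (homD M N g).1 (f.1 x) + n.negOnePow • g.1 ((homD L M f).1 x)
    rw [h1, h2, h3]
    simp [Int.negOnePow_add, smul_sub, smul_smul, mul_comm, comp_def]

end DGMod

/-! ### The dg-comma category -/

/-- An object `f : D → F(C)` of the dg-comma category `(𝒟, F(𝒞))`, where `f` is closed of
degree zero. -/
structure DGComma (K : Type w) [CommRing K]
    {C : Type u₁} [Category.{v₁} C] [Preadditive C] [Linear K C] [DGCategory K C]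
    {D : Type u₂} [Category.{v₂} D] [Preadditive D] [Linear K D] [DGCategory K D]
    (F : C ⥤ D) [IsDGFunctor K F] where
  left : D
  right : C
  hom : left ⟶ F.obj right
  hom_closed : DGCategory.IsClosedZero K hom

namespace DGComma

variable {K : Type w} [CommRing K]
  {C : Type u₁} [Category.{v₁} C] [Preadditive C] [Linear K C] [DGCategory K C]
  {D : Type u₂} [Category.{v₂} D] [Preadditive D] [Linear K D] [DGCategory K D]
  {F : C ⥤ D} [IsDGFunctor K F]

/-- The pairs `(α, β)` with `f' ∘ α = F(β) ∘ f`. -/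
def homSub (X Y : DGComma K F) :
    Submodule K ((X.left ⟶ Y.left) × (X.right ⟶ Y.right)) where
  carrier := {p | p.1 ≫ Y.hom = X.hom ≫ F.map p.2}
  zero_mem' := by
    have : F.map (0 : X.right ⟶ Y.right) = 0 := by
      simpa using IsDGFunctor.map_smul (K := K) (F := F) 0 (0 : X.right ⟶ Y.right)
    simp [this]
  add_mem' := fun {p q} hp hq => by
    simp only [Set.mem_ofPred_eq] at hp hq ⊢
    simp [IsDGFunctor.map_add (K := K) (F := F), hp, hq]
  smul_mem' := fun k p hp => by
    simp only [Set.mem_ofPred_eq] at hp ⊢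
    simp [IsDGFunctor.map_smul (K := K) (F := F), hp]

/-- The pairs `(α, β)` of degree `n`. -/
def pairGr (X Y : DGComma K F) (n : ℤ) :
    Submodule K ((X.left ⟶ Y.left) × (X.right ⟶ Y.right)) :=
  (DGCategory.gr X.left Y.left n).prod (DGCategory.gr X.right Y.right n)

/-- The morphisms of degree `n`. -/
def homGr (X Y : DGComma K F) (n : ℤ) : Submodule K (homSub X Y) :=
  (pairGr X Y n).comap (homSub X Y).subtype

theorem pairGr_iSupIndep (X Y : DGComma K F) : iSupIndep (pairGr X Y) := by
  intro n
  rw [Submodule.disjoint_def]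
  rintro ⟨a, b⟩ ⟨ha, hb⟩ h
  have h1 := (DGCategory.isInternal (K := K) X.left Y.left).submodule_iSupIndep n
  have h2 := (DGCategory.isInternal (K := K) X.right Y.right).submodule_iSupIndep n
  rw [Submodule.disjoint_def] at h1 h2
  refine Prod.ext (h1 a ha ?_) (h2 b hb ?_)
  · have hle : (⨆ m, ⨆ (_ : m ≠ n), pairGr X Y m) ≤
        (⨆ m, ⨆ (_ : m ≠ n), DGCategory.gr X.left Y.left m).comap (LinearMap.fst K _ _) :=
      iSup₂_le fun m hm p hp => (le_iSup₂_of_le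
        (f := fun m (_ : m ≠ n) => DGCategory.gr X.left Y.left m) m hm le_rfl) hp.1
    exact hle h
  · have hle : (⨆ m, ⨆ (_ : m ≠ n), pairGr X Y m) ≤
        (⨆ m, ⨆ (_ : m ≠ n), DGCategory.gr X.right Y.right m).comap (LinearMap.snd K _ _) :=
      iSup₂_le fun m hm p hp => (le_iSup₂_of_le
        (f := fun m (_ : m ≠ n) => DGCategory.gr X.right Y.right m) m hm le_rfl) hp.2
    exact hle h

theorem proj_mem_homSub {X Y : DGComma K F} {p : (X.left ⟶ Y.left) × (X.right ⟶ Y.right)}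
    (hp : p ∈ homSub X Y) (n : ℤ) :
    ((gradedProj (DGCategory.isInternal (K := K) X.left Y.left) n p.1,
      gradedProj (DGCategory.isInternal (K := K) X.right Y.right) n p.2) :
      (X.left ⟶ Y.left) × (X.right ⟶ Y.right)) ∈ homSub X Y := by
  have h1 : ∀ a : X.left ⟶ Y.left,
      gradedProj (DGCategory.isInternal (K := K) X.left Y.left) n a ≫ Y.hom =
      gradedProj (DGCategory.isInternal (K := K) X.left (F.obj Y.right)) n (a ≫ Y.hom) := by
    intro a
    refine gradedInduction (DGCategory.isInternal (K := K) X.left Y.left) a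
      (fun m a ha => ?_) (fun a b ha hb => ?_)
    · have := DGCategory.comp_mem ha Y.hom_closed.1
      rw [add_zero] at this
      rw [gradedProj_of_mem _ _ ha, gradedProj_of_mem _ _ this]
      split_ifs <;> simp
    · simp [ha, hb]
  have h2 : ∀ b : X.right ⟶ Y.right,
      X.hom ≫ F.map (gradedProj (DGCategory.isInternal (K := K) X.right Y.right) n b) =
      gradedProj (DGCategory.isInternal (K := K) X.left (F.obj Y.right)) n
        (X.hom ≫ F.map b) := by
    intro b
    refine gradedInduction (DGCategory.isInternal (K := K) X.right Y.right) b
      (fun m b hb => ?_) (fun a b ha hb => ?_)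
    · have := DGCategory.comp_mem X.hom_closed.1 (IsDGFunctor.map_mem (F := F) hb)
      rw [zero_add] at this
      rw [gradedProj_of_mem _ _ hb, gradedProj_of_mem _ _ this]
      split_ifs
      · rfl
      · have h0 := (homSub X Y).zero_mem
        exact (show (0 : X.left ⟶ Y.left) ≫ Y.hom = X.hom ≫ F.map 0 from h0).symm.trans
          (by simp)
    · simp [IsDGFunctor.map_add (K := K) (F := F), ha, hb]
  change _ ≫ _ = _ ≫ _
  rw [h1, h2]
  exact congrArg _ hp

theorem homGr_isInternal (X Y : DGComma K F) : DirectSum.IsInternal (homGr X Y) := by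
  refine isInternal_comap (pairGr_iSupIndep X Y) _ ?_
  rintro ⟨a, b⟩ hp
  obtain ⟨s₁, h₁⟩ := sum_gradedProj (DGCategory.isInternal (K := K) X.left Y.left) a
  obtain ⟨s₂, h₂⟩ := sum_gradedProj (DGCategory.isInternal (K := K) X.right Y.right) b
  have h : ((a, b) : (X.left ⟶ Y.left) × (X.right ⟶ Y.right)) = ∑ n ∈ s₁ ∪ s₂,
      (gradedProj (DGCategory.isInternal (K := K) X.left Y.left) n a,
        gradedProj (DGCategory.isInternal (K := K) X.right Y.right) n b) := by
    refine Prod.ext ?_ ?_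
    · rw [Prod.fst_sum]
      exact (h₁ _ Finset.subset_union_left).symm
    · rw [Prod.snd_sum]
      exact (h₂ _ Finset.subset_union_right).symm
  rw [h]
  refine sum_mem fun n _ => ?_
  exact (le_iSup (fun n => pairGr X Y n ⊓ homSub X Y) n)
    ⟨⟨gradedProj_mem _ n a, gradedProj_mem _ n b⟩, proj_mem_homSub hp n⟩

theorem d_mem_homSub {X Y : DGComma K F} (p : homSub X Y) :
    ((DGCategory.d (K := K) X.left Y.left p.1.1, DGCategory.d (K := K) X.right Y.right p.1.2) :
      (X.left ⟶ Y.left) × (X.right ⟶ Y.right)) ∈ homSub X Y := by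
  refine gradedInduction (homGr_isInternal X Y) p (fun n p hp => ?_) (fun p q hp hq => ?_)
  · have h : p.1.1 ≫ Y.hom = X.hom ≫ F.map p.1.2 := p.2
    have h1 := DGCategory.d_comp hp.1 Y.hom_closed.1
    have h2 := DGCategory.d_comp X.hom_closed.1 (IsDGFunctor.map_mem (F := F) hp.2)
    rw [Y.hom_closed.2] at h1
    rw [X.hom_closed.2, ← IsDGFunctor.map_d] at h2
    change _ ≫ _ = _ ≫ _
    simp only [Submodule.subtype_apply] at h1 h2
    rw [h, h2] at h1
    simpa using h1.symm
  · have := add_mem hp hq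
    simpa using this

instance : Category (DGComma K F) where
  Hom X Y := homSub X Y
  id X := ⟨(𝟙 _, 𝟙 _), show 𝟙 _ ≫ _ = _ ≫ F.map (𝟙 _) by simp⟩
  comp {X Y Z} p q := ⟨(p.1.1 ≫ q.1.1, p.1.2 ≫ q.1.2), by
    have hp : p.1.1 ≫ Y.hom = X.hom ≫ F.map p.1.2 := p.2
    have hq : q.1.1 ≫ Z.hom = Y.hom ≫ F.map q.1.2 := q.2
    change (p.1.1 ≫ q.1.1) ≫ Z.hom = X.hom ≫ F.map (p.1.2 ≫ q.1.2)
    rw [Category.assoc, hq, ← Category.assoc, hp, Category.assoc, F.map_comp]⟩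
  id_comp p := Subtype.ext (Prod.ext (Category.id_comp _) (Category.id_comp _))
  comp_id p := Subtype.ext (Prod.ext (Category.comp_id _) (Category.comp_id _))
  assoc p q r := Subtype.ext (Prod.ext (Category.assoc _ _ _) (Category.assoc _ _ _))

instance : Preadditive (DGComma K F) where
  homGroup X Y := inferInstanceAs (AddCommGroup (homSub X Y))
  add_comp _ _ _ _ _ _ :=
    Subtype.ext (Prod.ext (Preadditive.add_comp _ _ _ _ _ _) (Preadditive.add_comp _ _ _ _ _ _))
  comp_add _ _ _ _ _ _ :=
    Subtype.ext (Prod.ext (Preadditive.comp_add _ _ _ _ _ _) (Preadditive.comp_add _ _ _ _ _ _))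

instance : Linear K (DGComma K F) where
  homModule X Y := inferInstanceAs (Module K (homSub X Y))
  smul_comp _ _ _ _ _ _ :=
    Subtype.ext (Prod.ext (Linear.smul_comp _ _ _ _ _ _) (Linear.smul_comp _ _ _ _ _ _))
  comp_smul _ _ _ _ _ _ :=
    Subtype.ext (Prod.ext (Linear.comp_smul _ _ _ _ _ _) (Linear.comp_smul _ _ _ _ _ _))

/-- The differential `(α, β) ↦ (d α, d β)`. -/
def homD (X Y : DGComma K F) : homSub X Y →ₗ[K] homSub X Y where
  toFun p := ⟨(DGCategory.d X.left Y.left p.1.1, DGCategory.d X.right Y.right p.1.2),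
    d_mem_homSub p⟩
  map_add' p q := Subtype.ext (Prod.ext (map_add _ _ _) (map_add _ _ _))
  map_smul' k p := Subtype.ext (Prod.ext (map_smul _ _ _) (map_smul _ _ _))

instance : DGCategory K (DGComma K F) where
  gr := homGr
  isInternal := homGr_isInternal
  d := homD
  d_mem := fun hf => ⟨DGCategory.d_mem hf.1, DGCategory.d_mem hf.2⟩
  d_d := fun f => Subtype.ext (Prod.ext (DGCategory.d_d _) (DGCategory.d_d _))
  comp_mem := fun hf hg => ⟨DGCategory.comp_mem hf.1 hg.1, DGCategory.comp_mem hf.2 hg.2⟩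
  d_comp := fun hf hg =>
    Subtype.ext (Prod.ext (DGCategory.d_comp hf.1 hg.1) (DGCategory.d_comp hf.2 hg.2))

end DGComma

/-! ### The dg-functor `Hom_U(N, -)` -/

namespace DGBimod

variable {K : Type w} [CommRing K] {U : DGAlg.{w, u₂} K} {T : DGAlg.{w, u₁} K}

/-- Right multiplication `m ↦ m t`. -/
def rmul (N : DGBimod.{w, u₁, u₂, v} U T) : T →ₗ[K] N →ₗ[K] N :=
  LinearMap.mk₂ K (fun t m => MulOpposite.op t • m)
    (fun s t m => by rw [MulOpposite.op_add, add_smul])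
    (fun k t m => by rw [MulOpposite.op_smul, smul_assoc])
    (fun t m n => smul_add _ _ _)
    (fun k t m => by
      rw [algebra_compatible_smul (T.carrier)ᵐᵒᵖ k m,
        algebra_compatible_smul (T.carrier)ᵐᵒᵖ k (MulOpposite.op t • m), smul_smul, smul_smul,
        Algebra.commutes])

@[simp] theorem rmul_apply (N : DGBimod.{w, u₁, u₂, v} U T) (t : T) (m : N) :
    N.rmul t m = MulOpposite.op t • m := rfl

/-- For `t` of degree `i`, the map
`η ↦ (m ↦ (-1) ^ (i |η|) η((-1) ^ (i |m|) m t))`. -/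
def actDeg (N : DGBimod.{w, u₁, u₂, v} U T) (B : DGMod.{w, u₂, v} U) (i : ℤ) :
    T →ₗ[K] DGMod.homTotal N.toDGMod B →ₗ[K] (N →ₗ[K] B) :=
  LinearMap.mk₂ K (fun t η => (koszulSign (DGMod.homGr_isInternal N.toDGMod B) i η).1 ∘ₗ
      N.rmul t ∘ₗ koszulSign N.isInternal i)
    (fun s t η => by ext m; simp)
    (fun k t η => by ext m; simp)
    (fun t η θ => by ext m; simp)
    (fun k t η => by ext m; simp)

/-- The left action of `T` on `Hom_U(N, B)`:
`(t η)(m) = (-1) ^ (|t| (|η| + |m|)) η(m t)` for homogeneous `t`, `η`, `m`. -/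
def act (N : DGBimod.{w, u₁, u₂, v} U T) (B : DGMod.{w, u₂, v} U) :
    T →ₗ[K] DGMod.homTotal N.toDGMod B →ₗ[K] (N →ₗ[K] B) :=
  gradedLift T.isInternal (N.actDeg B)

theorem act_of_mem {N : DGBimod.{w, u₁, u₂, v} U T} {B : DGMod.{w, u₂, v} U} {i n j : ℤ} {t : T}
    (ht : t ∈ T.gr i) {η : DGMod.homTotal N.toDGMod B} (hη : η.1 ∈ DGMod.homDeg N.toDGMod B n)
    {m : N} (hm : m ∈ N.gr j) :
    N.act B t η m = (i * (n + j)).negOnePow • η.1 (MulOpposite.op t • m) := by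
  rw [act, gradedLift_of_mem _ _ ht]
  change (koszulSign (DGMod.homGr_isInternal N.toDGMod B) i η).1
    (N.rmul t (koszulSign N.isInternal i m)) = _
  rw [koszulSign_of_mem (DGMod.homGr_isInternal N.toDGMod B) i (x := η) (n := n) hη,
    koszulSign_of_mem N.isInternal i hm, map_negOnePow_smul, mul_add, Int.negOnePow_add,
    mul_smul, rmul_apply]
  change (i * n).negOnePow • η.1 ((i * j).negOnePow • _) = _
  rw [map_negOnePow_smul]

theorem act_mem_homDeg {N : DGBimod.{w, u₁, u₂, v} U T} {B : DGMod.{w, u₂, v} U} {i n : ℤ} {t : T}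
    (ht : t ∈ T.gr i) {η : DGMod.homTotal N.toDGMod B}
    (hη : η.1 ∈ DGMod.homDeg N.toDGMod B n) :
    N.act B t η ∈ DGMod.homDeg N.toDGMod B (i + n) := by
  constructor
  · intro j m hm
    rw [act_of_mem ht hη hm]
    refine negOnePow_smul_mem _ _ ?_
    have := hη.1 _ _ (N.rsmul_mem hm ht)
    rwa [add_assoc] at this
  · intro j a ha x
    refine gradedInduction N.isInternal x (fun l m hm => ?_) (fun x y hx hy => ?_)
    · rw [act_of_mem ht hη hm, act_of_mem ht hη (N.smul_mem ha hm),
        DGMod.negOnePow_smul_comm, hη.2 j a ha, smul_comm a (MulOpposite.op t) m, smul_smul,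
        smul_smul, ← Int.negOnePow_add, ← Int.negOnePow_add]
      congr 1
      rw [Int.negOnePow_eq_iff]
      ring_nf
      simp
    · simp only [map_add, smul_add, hx, hy]

theorem act_mem_homTotal {N : DGBimod.{w, u₁, u₂, v} U T} {B : DGMod.{w, u₂, v} U} (t : T)
    (η : DGMod.homTotal N.toDGMod B) : N.act B t η ∈ DGMod.homTotal N.toDGMod B := by
  refine gradedInduction T.isInternal t (fun i t ht => ?_) (fun s t hs ht => ?_)
  · refine DGMod.homGr_induction η (fun n η hη => ?_) (fun η θ hη hθ => ?_)
    · exact DGMod.homDeg_le _ _ _ (act_mem_homDeg ht hη)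
    · rw [map_add]
      exact add_mem hη hθ
  · rw [map_add]
    exact add_mem hs ht

/-- The left `T`-module structure of `Hom_U(N, B)`. -/
@[reducible] def homModule (N : DGBimod.{w, u₁, u₂, v} U T) (B : DGMod.{w, u₂, v} U) :
    Module T (DGMod.homTotal N.toDGMod B) where
  smul t η := ⟨N.act B t η, act_mem_homTotal t η⟩
  one_smul η := by
    refine DGMod.homTotal_ext fun m => ?_
    change N.act B 1 η m = η.1 m
    refine DGMod.homGr_induction η (fun n η hη => ?_) (fun η θ hη hθ => ?_)
    · refine gradedInduction N.isInternal m (fun j m hm => ?_) (fun x y hx hy => ?_)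
      · rw [act_of_mem (SetLike.GradedOne.one_mem (A := T.gr)) hη hm]
        simp
      · rw [map_add, map_add, hx, hy]
    · rw [map_add, LinearMap.add_apply, hη, hθ]
      rfl
  mul_smul s t η := by
    refine DGMod.homTotal_ext fun m => ?_
    change N.act B (s * t) η m = N.act B s ⟨N.act B t η, act_mem_homTotal t η⟩ m
    refine gradedInduction N.isInternal m (fun j m hm => ?_) (fun x y hx hy => ?_)
    · refine gradedInduction T.isInternal s (fun a s hs => ?_) (fun x y hx hy => ?_)
      · refine gradedInduction T.isInternal t (fun b t ht => ?_) (fun x y hx hy => ?_)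
        · refine DGMod.homGr_induction η (fun n η hη => ?_) (fun η θ hη hθ => ?_)
          · rw [act_of_mem (SetLike.GradedMul.mul_mem hs ht) hη hm,
              act_of_mem hs (act_mem_homDeg ht hη) hm]
            change _ = _ • N.act B t η _
            rw [act_of_mem ht hη (N.rsmul_mem hm hs), smul_smul, MulOpposite.op_mul, mul_smul,
              ← Int.negOnePow_add]
            congr 1
            rw [Int.negOnePow_eq_iff]
            ring_nf
            simp
          · have h : (⟨N.act B t (η + θ), act_mem_homTotal t (η + θ)⟩ :
                DGMod.homTotal N.toDGMod B) =
                ⟨N.act B t η, act_mem_homTotal t η⟩ + ⟨N.act B t θ, act_mem_homTotal t θ⟩ :=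
              Subtype.ext (map_add _ _ _)
            rw [h, map_add, map_add, LinearMap.add_apply, LinearMap.add_apply, hη, hθ]
        · have h : (⟨N.act B (x + y) η, act_mem_homTotal (x + y) η⟩ :
              DGMod.homTotal N.toDGMod B) =
              ⟨N.act B x η, act_mem_homTotal x η⟩ + ⟨N.act B y η, act_mem_homTotal y η⟩ :=
            Subtype.ext (by simp)
          rw [h, mul_add, map_add, map_add, LinearMap.add_apply, LinearMap.add_apply,
            LinearMap.add_apply, hx, hy]
      · rw [add_mul, map_add, map_add, LinearMap.add_apply, LinearMap.add_apply,
          LinearMap.add_apply, LinearMap.add_apply, hx, hy]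
    · rw [map_add, map_add, hx, hy]
  smul_zero t := Subtype.ext (map_zero (N.act B t))
  smul_add t η θ := Subtype.ext (map_add (N.act B t) η θ)
  add_smul s t η := Subtype.ext (by
    change N.act B (s + t) η = N.act B s η + N.act B t η
    rw [map_add]
    rfl)
  zero_smul η := Subtype.ext (by
    change N.act B 0 η = 0
    rw [map_zero]
    rfl)

attribute [local instance] homModule

theorem smul_val (N : DGBimod.{w, u₁, u₂, v} U T) (B : DGMod.{w, u₂, v} U) (t : T)
    (η : DGMod.homTotal N.toDGMod B) : (t • η).1 = N.act B t η := rfl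

/-- The dg-`T`-module `Hom_U(N, B)`. -/
@[reducible] def homObj (N : DGBimod.{w, u₁, u₂, v} U T) (B : DGMod.{w, u₂, v} U) : DGMod.{w, u₁, v} T where
  toDGKMod := DGMod.homDG N.toDGMod B
  module := N.homModule B
  isScalarTower := ⟨fun k t η => Subtype.ext (by
    change N.act B (k • t) η = k • N.act B t η
    rw [map_smul]
    rfl)⟩
  smul_mem := fun ht hη => act_mem_homDeg ht hη
  d_smul := fun {i t} ht η => by
    refine DGMod.homTotal_ext fun m => ?_
    change (DGMod.homD N.toDGMod B (t • η)).1 m =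
      N.act B (T.d t) η m + i.negOnePow • N.act B t (DGMod.homD N.toDGMod B η) m
    refine gradedInduction N.isInternal m (fun j m hm => ?_) (fun x y hx hy => ?_)
    · refine DGMod.homGr_induction η (fun n η hη => ?_) (fun η θ hη hθ => ?_)
      · rw [DGMod.homD_of_mem (n := i + n) (t • η) (act_mem_homDeg ht hη),
          act_of_mem (T.d_mem ht) hη hm,
          act_of_mem ht (n := n + 1) (DGMod.homDAux_mem η hη) hm, DGMod.homD_of_mem η hη]
        change B.d (N.act B t η m) - (i + n).negOnePow • N.act B t η (N.d m) = _
        rw [act_of_mem ht hη hm, act_of_mem ht hη (N.d_mem hm)]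
        change _ = _ + _ • _ • (B.d (η.1 (MulOpposite.op t • m)) -
          n.negOnePow • η.1 (N.d (MulOpposite.op t • m)))
        rw [N.d_rsmul hm t, map_add, map_negOnePow_smul, map_negOnePow_smul]
        have key : ∀ P Q R : B, (i * (n + j)).negOnePow • P -
            (i + n).negOnePow • (i * (n + (j + 1))).negOnePow • Q =
            ((i + 1) * (n + j)).negOnePow • R + i.negOnePow • (i * (n + 1 + j)).negOnePow •
              (P - n.negOnePow • (Q + j.negOnePow • R)) := by
          intro P Q R
          simp only [mul_add, add_mul, mul_one, one_mul, Int.negOnePow_add]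
          generalize i.negOnePow = a
          generalize n.negOnePow = b
          generalize j.negOnePow = c
          generalize (i * n).negOnePow = p
          generalize (i * j).negOnePow = q
          rcases Int.units_eq_one_or a with rfl | rfl <;>
            rcases Int.units_eq_one_or b with rfl | rfl <;>
            rcases Int.units_eq_one_or c with rfl | rfl <;>
            rcases Int.units_eq_one_or p with rfl | rfl <;>
            rcases Int.units_eq_one_or q with rfl | rfl <;> simp <;> abel
        exact key _ _ _
      · rw [smul_add, map_add, map_add, map_add, map_add, DGMod.homTotal_add_apply,
          LinearMap.add_apply, LinearMap.add_apply, hη, hθ, smul_add]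
        abel
    · simp only [map_add, hx, hy, smul_add]
      abel

/-- Composition with `β : B → B'`, as a `K`-linear map `Hom_U(N, B) → Hom_U(N, B')`. -/
def postcomp (N : DGBimod.{w, u₁, u₂, v} U T) {B B' : DGMod.{w, u₂, v} U} (β : B ⟶ B') :
    DGMod.homTotal N.toDGMod B →ₗ[K] DGMod.homTotal N.toDGMod B' where
  toFun η := ⟨β.1 ∘ₗ η.1, DGMod.comp_mem_homTotal η β⟩
  map_add' η θ := Subtype.ext (LinearMap.comp_add _ _ _)
  map_smul' k η := Subtype.ext (LinearMap.comp_smul _ _ _)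

theorem postcomp_val (N : DGBimod.{w, u₁, u₂, v} U T) {B B' : DGMod.{w, u₂, v} U} (β : B ⟶ B')
    (η : DGMod.homTotal N.toDGMod B) (m : N) :
    (N.postcomp β η).1 m = β.1 (η.1 m) := rfl

theorem postcomp_add (N : DGBimod.{w, u₁, u₂, v} U T) {B B' : DGMod.{w, u₂, v} U}
    (β γ : B ⟶ B') : N.postcomp (β + γ) = N.postcomp β + N.postcomp γ := rfl

theorem postcomp_mem_homDeg (N : DGBimod.{w, u₁, u₂, v} U T) {B B' : DGMod.{w, u₂, v} U}
    {k : ℤ} {β : B ⟶ B'} (hβ : β.1 ∈ DGMod.homDeg B B' k) :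
    N.postcomp β ∈ DGMod.homDeg (N.homObj B) (N.homObj B') k := by
  refine ⟨fun i η hη => DGMod.comp_mem_homDeg hη hβ, fun i t ht η => ?_⟩
  refine DGMod.homTotal_ext fun m => ?_
  change N.act B' t (N.postcomp β η) m = ((k * i).negOnePow • N.postcomp β (t • η)).1 m
  change _ = (k * i).negOnePow • β.1 (N.act B t η m)
  refine gradedInduction N.isInternal m (fun j m hm => ?_) (fun x y hx hy => ?_)
  · refine DGMod.homGr_induction η (fun n η hη => ?_) (fun η θ hη hθ => ?_)
    · rw [act_of_mem ht (n := n + k) (η := N.postcomp β η) (DGMod.comp_mem_homDeg hη hβ) hm, act_of_mem ht hη hm,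
        postcomp_val, map_negOnePow_smul, smul_smul, ← Int.negOnePow_add]
      congr 2
      ring
    · rw [map_add (N.postcomp β), map_add, map_add, LinearMap.add_apply, LinearMap.add_apply,
        hη, hθ, map_add, smul_add]
  · rw [map_add, map_add, hx, hy, map_add, smul_add]

theorem postcomp_mem_homTotal (N : DGBimod.{w, u₁, u₂, v} U T) {B B' : DGMod.{w, u₂, v} U}
    (β : B ⟶ B') : N.postcomp β ∈ DGMod.homTotal (N.homObj B) (N.homObj B') := by
  refine DGMod.homGr_induction β (fun n β hβ => ?_) (fun β γ hβ hγ => ?_)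
  · exact DGMod.homDeg_le _ _ _ (N.postcomp_mem_homDeg hβ)
  · change N.postcomp β + N.postcomp γ ∈ _
    exact add_mem hβ hγ

/-- The functor `Hom_U(N, -) : DgMod(U) ⥤ DgMod(T)`, given by `β ↦ (η ↦ β ∘ η)` on morphisms. -/
def homFunctor (N : DGBimod.{w, u₁, u₂, v} U T) : DGMod.{w, u₂, v} U ⥤ DGMod.{w, u₁, v} T where
  obj B := N.homObj B
  map β := ⟨N.postcomp β, N.postcomp_mem_homTotal β⟩

instance (N : DGBimod.{w, u₁, u₂, v} U T) : IsDGFunctor K N.homFunctor where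
  map_add β γ := rfl
  map_smul k β := rfl
  map_mem hβ := N.postcomp_mem_homDeg hβ
  map_d {B B'} β := by
    refine DGMod.homTotal_ext fun η => DGMod.homTotal_ext fun m => ?_
    change (DGMod.homD B B' β).1 (η.1 m) = ((DGMod.homD (N.homObj B) (N.homObj B')
      ⟨N.postcomp β, N.postcomp_mem_homTotal β⟩).1 η).1 m
    refine DGMod.homGr_induction β (fun k β hβ => ?_) (fun β γ hβ hγ => ?_)
    · rw [DGMod.homD_of_mem β hβ, DGMod.homD_of_mem _ (N.postcomp_mem_homDeg hβ)]
      change _ = (DGMod.homD N.toDGMod B' (N.postcomp β η)).1 m -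
        k.negOnePow • β.1 ((DGMod.homD N.toDGMod B η).1 m)
      refine DGMod.homGr_induction η (fun n η hη => ?_) (fun η θ hη hθ => ?_)
      · rw [DGMod.homD_of_mem η hη,
          DGMod.homD_of_mem (N.postcomp β η) (DGMod.comp_mem_homDeg hη hβ)]
        change B'.d (β.1 (η.1 m)) - k.negOnePow • β.1 (B.d (η.1 m)) =
          (B'.d (β.1 (η.1 m)) - (n + k).negOnePow • β.1 (η.1 (N.d m))) -
            k.negOnePow • β.1 (B.d (η.1 m) - n.negOnePow • η.1 (N.d m))
        rw [map_sub, map_negOnePow_smul, Int.negOnePow_add, smul_sub, smul_smul,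
          mul_comm n.negOnePow]
        abel
      · have h : N.postcomp β (η + θ) = N.postcomp β η + N.postcomp β θ := map_add _ _ _
        rw [h, map_add, map_add, DGMod.homTotal_add_apply, DGMod.homTotal_add_apply,
          DGMod.homTotal_add_apply, map_add, map_add, smul_add, hη, hθ]
        abel
    · have h : (⟨N.postcomp (β + γ), N.postcomp_mem_homTotal (β + γ)⟩ :
          DGMod.homTotal (N.homObj B) (N.homObj B')) =
          ⟨N.postcomp β, N.postcomp_mem_homTotal β⟩ +
            ⟨N.postcomp γ, N.postcomp_mem_homTotal γ⟩ := rfl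
      rw [h, map_add, map_add, DGMod.homTotal_add_apply, hβ, hγ]
      rfl

end DGBimod

/-! ### Triangular matrix algebras -/

/-- An identification of the dg-`K`-algebra `Λ` with the triangular matrices
`[[t, 0], [m, u]]`, written as triples `(t, m, u)`, with the matrix multiplication and with
entrywise linear structure, grading and differential. -/
structure DGBimod.TriangularMatrixAlgebra {K : Type w} [CommRing K]
    {U : DGAlg.{w, u₂} K} {T : DGAlg.{w, u₁} K} (N : DGBimod.{w, u₁, u₂, v} U T)
    (Λ : DGAlg.{w, u} K) where
  entries : Λ ≃ₗ[K] T × N × U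
  entries_one : entries 1 = (1, 0, 1)
  entries_mul : ∀ x y : Λ, entries (x * y) =
    ((entries x).1 * (entries y).1,
      MulOpposite.op (entries y).1 • (entries x).2.1 + (entries x).2.2 • (entries y).2.1,
      (entries x).2.2 * (entries y).2.2)
  mem_gr_iff : ∀ (n : ℤ) (x : Λ), x ∈ Λ.gr n ↔
    (entries x).1 ∈ T.gr n ∧ (entries x).2.1 ∈ N.gr n ∧ (entries x).2.2 ∈ U.gr n
  entries_d : ∀ x : Λ, entries (Λ.d x) =
    (T.d (entries x).1, N.d (entries x).2.1, U.d (entries x).2.2)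

end

/-!
A left module `M` over the triangular matrices `Λ` splits as `e₁ M ⊕ e₂ M` along the diagonal
idempotents, which are closed of degree zero. Here `A = e₁ M` is a dg-`T`-module, `B = e₂ M` is a
dg-`U`-module, and the corner `N` of `Λ` acts by a `T`-balanced, `U`-linear pairing `N × A → B` that
satisfies the Leibniz rule. By the tensor-hom adjunction such a pairing is the same thing as a
closed morphism `f : A → Hom_U(N, B)` of degree zero, and with the sign conventions at hand the
dictionary is `m a = (-1) ^ (|m| |a|) f(a)(m)` (`DGBimod.isDGPairing_pairing` and
`DGBimod.IsDGPairing.exists_closed`).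

Conversely, every object `(A, f, B)` of the comma category gives a `Λ`-module of column vectors
`(a, b)`. A homogeneous morphism between column modules commutes with `e₁` and `e₂`, so it is
diagonal, and linearity over the corner `N` is exactly the condition `f' ∘ α = G(β) ∘ f`
(`DGBimod.TriangularMatrixAlgebra.prodMap_mem_homDeg_iff` and `DGBimod.pairing_comp_iff`). The column
functor is therefore fully faithful, and the splitting of `M` shows that it reaches every module up
to a closed isomorphism of degree zero; `DGEquivalence.nonempty_of_fullyFaithful` turns this into an
equivalence of dg-categories.
-/

noncomputable section

/-! ### Products and sign twists of graded modules -/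

section Graded

variable {K : Type w} [CommRing K] {X : Type v} [AddCommGroup X] [Module K X]
  {Y : Type v₁} [AddCommGroup Y] [Module K Y] {Z : Type v₂} [AddCommGroup Z] [Module K Z]
  {grX : ℤ → Submodule K X} {grY : ℤ → Submodule K Y}

theorem isInternal_prod (hX : DirectSum.IsInternal grX) (hY : DirectSum.IsInternal grY) :
    DirectSum.IsInternal fun n => (grX n).prod (grY n) := by
  rw [DirectSum.isInternal_submodule_iff_iSupIndep_and_iSup_eq_top]
  constructor
  · intro n
    rw [Submodule.disjoint_def]
    rintro ⟨x, y⟩ ⟨hx, hy⟩ h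
    have h1 := hX.submodule_iSupIndep n
    have h2 := hY.submodule_iSupIndep n
    rw [Submodule.disjoint_def] at h1 h2
    have hle1 : (⨆ m, ⨆ (_ : m ≠ n), (grX m).prod (grY m)) ≤
        (⨆ m, ⨆ (_ : m ≠ n), grX m).comap (LinearMap.fst K X Y) :=
      iSup₂_le fun m hm p hp =>
        (le_iSup₂_of_le (f := fun m (_ : m ≠ n) => grX m) m hm le_rfl) hp.1
    have hle2 : (⨆ m, ⨆ (_ : m ≠ n), (grX m).prod (grY m)) ≤
        (⨆ m, ⨆ (_ : m ≠ n), grY m).comap (LinearMap.snd K X Y) :=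
      iSup₂_le fun m hm p hp =>
        (le_iSup₂_of_le (f := fun m (_ : m ≠ n) => grY m) m hm le_rfl) hp.2
    exact Prod.ext (h1 x hx (hle1 h)) (h2 y hy (hle2 h))
  · rw [eq_top_iff]
    rintro ⟨x, y⟩ -
    have h1 : ((x, 0) : X × Y) ∈ ⨆ n, (grX n).prod (grY n) :=
      gradedInduction hX x
        (fun n x hx => Submodule.mem_iSup_of_mem n ⟨hx, zero_mem (grY n)⟩)
        fun x x' hx hx' => by simpa using add_mem hx hx'
    have h2 : ((0, y) : X × Y) ∈ ⨆ n, (grX n).prod (grY n) :=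
      gradedInduction hY y
        (fun n y hy => Submodule.mem_iSup_of_mem n ⟨zero_mem (grX n), hy⟩)
        fun y y' hy hy' => by simpa using add_mem hy hy'
    simpa using add_mem h1 h2

/-- The flip of a bilinear map of graded modules, with the Koszul sign:
`(y, x) ↦ (-1) ^ (|y| |x|) φ(x, y)`. -/
def koszulFlip (hX : DirectSum.IsInternal grX) (hY : DirectSum.IsInternal grY)
    (φ : X →ₗ[K] Y →ₗ[K] Z) : Y →ₗ[K] X →ₗ[K] Z :=
  gradedLift hY fun j => LinearMap.lcomp K Z (koszulSign hX j) ∘ₗ φ.flip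

theorem koszulFlip_of_mem (hX : DirectSum.IsInternal grX) (hY : DirectSum.IsInternal grY)
    (φ : X →ₗ[K] Y →ₗ[K] Z) {i j : ℤ} {x : X} {y : Y} (hx : x ∈ grX i) (hy : y ∈ grY j) :
    koszulFlip hX hY φ y x = (i * j).negOnePow • φ x y := by
  rw [koszulFlip, gradedLift_of_mem _ _ hy]
  change φ (koszulSign hX j x) y = _
  rw [koszulSign_of_mem _ _ hx, map_negOnePow_smul, mul_comm]
  rfl

theorem koszulFlip_koszulFlip (hX : DirectSum.IsInternal grX) (hY : DirectSum.IsInternal grY)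
    (φ : X →ₗ[K] Y →ₗ[K] Z) : koszulFlip hY hX (koszulFlip hX hY φ) = φ :=
  gradedExt hX fun i x hx => gradedExt hY fun j y hy => by
    rw [koszulFlip_of_mem _ _ _ hy hx, koszulFlip_of_mem _ _ _ hx hy, mul_comm j i, smul_smul,
      Int.units_mul_self, one_smul]

end Graded

/-! ### A criterion for equivalences of dg-categories -/

section Criterion

variable {K : Type w} [CommRing K]
  {C : Type u₁} [Category.{v₁} C] [Preadditive C] [Linear K C] [DGCategory K C]
  {D : Type u₂} [Category.{v₂} D] [Preadditive D] [Linear K D] [DGCategory K D]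

open DGCategory

/-- Conjugation by closed isomorphisms of degree zero preserves degrees. -/
theorem DGCategory.conj_mem {X X' Y Y' : C} {i : X' ⟶ X} {j : Y ⟶ Y'}
    (hi : IsClosedZero K i) (hj : IsClosedZero K j) {n : ℤ} {f : X ⟶ Y}
    (hf : f ∈ gr (K := K) X Y n) : i ≫ f ≫ j ∈ gr (K := K) X' Y' n := by
  have := comp_mem hi.1 (comp_mem hf hj.1)
  rwa [zero_add, add_zero] at this

theorem DGCategory.d_conj {X X' Y Y' : C} {i : X' ⟶ X} {j : Y ⟶ Y'}
    (hi : IsClosedZero K i) (hj : IsClosedZero K j) (f : X ⟶ Y) :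
    d (K := K) X' Y' (i ≫ f ≫ j) = i ≫ d (K := K) X Y f ≫ j := by
  refine gradedInduction (isInternal (K := K) X Y) f (fun n f hf => ?_) (fun f g hf hg => ?_)
  · rw [d_comp hi.1 (comp_mem hf hj.1), d_comp hf hj.1, hi.2, hj.2]
    simp
  · simp only [Preadditive.add_comp, Preadditive.comp_add, map_add, hf, hg]

/-- A dg-functor that is bijective on morphisms, with homogeneous preimages of homogeneous
morphisms, and that reaches every object up to an isomorphism which is closed of degree zero
together with its inverse, is part of an equivalence of dg-categories. -/
theorem DGEquivalence.nonempty_of_fullyFaithful (F : C ⥤ D) [IsDGFunctor K F] [F.Faithful]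
    (hfull : ∀ {X Y : C} {n : ℤ} (g : F.obj X ⟶ F.obj Y),
      g ∈ gr (K := K) (F.obj X) (F.obj Y) n → ∃ f ∈ gr (K := K) X Y n, F.map f = g)
    (hess : ∀ Y : D, ∃ (X : C) (i : F.obj X ≅ Y), IsClosedZero K i.hom ∧ IsClosedZero K i.inv) :
    Nonempty (DGEquivalence K C D) := by
  have hsurj : ∀ {X Y : C} (g : F.obj X ⟶ F.obj Y), ∃ f, F.map f = g := by
    intro X Y g
    refine gradedInduction (isInternal (K := K) _ _) g (fun n g hg => ?_) (fun g h hg hh => ?_)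
    · obtain ⟨f, -, hf⟩ := hfull g hg
      exact ⟨f, hf⟩
    · obtain ⟨f, rfl⟩ := hg
      obtain ⟨f', rfl⟩ := hh
      exact ⟨f + f', IsDGFunctor.map_add (K := K) f f'⟩
  have : F.Full := ⟨fun g => hsurj g⟩
  have hrefl : ∀ {X Y : C} {n : ℤ} (f : X ⟶ Y), F.map f ∈ gr (K := K) (F.obj X) (F.obj Y) n →
      f ∈ gr (K := K) X Y n := by
    intro X Y n f hf
    obtain ⟨f', hf', h⟩ := hfull _ hf
    rwa [← F.map_injective h]
  have hclosed : ∀ {X Y : C} (f : X ⟶ Y), IsClosedZero K (F.map f) → IsClosedZero K f :=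
    fun f hf => ⟨hrefl f hf.1, F.map_injective (by rw [IsDGFunctor.map_d, hf.2, F.map_zero])⟩
  choose G i hi hi' using hess
  let R : D ⥤ C :=
    { obj := G
      map := fun {Y Z} g => F.preimage ((i Y).hom ≫ g ≫ (i Z).inv)
      map_id := fun Y => F.map_injective (by simp)
      map_comp := fun g h => F.map_injective (by simp) }
  have hR : ∀ {Y Z : D} (g : Y ⟶ Z), F.map (R.map g) = (i Y).hom ≫ g ≫ (i Z).inv :=
    fun g => F.map_preimage _
  -- The unit at `X` is the preimage of `(i (F X))⁻¹`, so that the triangle identity is immediate.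
  let unit : 𝟭 C ≅ F ⋙ R := NatIso.ofComponents (fun X => F.preimageIso (i (F.obj X)).symm)
    fun f => F.map_injective (by
      change F.map (f ≫ _) = F.map (_ ≫ R.map (F.map f))
      rw [F.map_comp, F.map_comp, hR]
      simp)
  let counit : R ⋙ F ≅ 𝟭 D := NatIso.ofComponents (fun Y => i Y) fun g => by
    change F.map (R.map g) ≫ _ = _
    rw [hR]
    simp
  have hunit : ∀ X, F.map (unit.hom.app X) = (i (F.obj X)).inv := fun X => F.map_preimage _
  exact ⟨{
    toEquivalence :=
      { functor := F
        inverse := R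
        unitIso := unit
        counitIso := counit
        functor_unitIso_comp := fun X => by
          rw [hunit]
          exact (i (F.obj X)).inv_hom_id }
    functor_dg := inferInstance
    inverse_dg :=
      { map_add := fun f g => F.map_injective (by
          rw [hR, IsDGFunctor.map_add (K := K), hR, hR]
          simp)
        map_smul := fun k f => F.map_injective (by
          rw [hR, IsDGFunctor.map_smul (K := K), hR]
          simp)
        map_mem := fun {Y Z n f} hf => hrefl _ (by
          rw [hR]
          exact conj_mem (hi Y) (hi' Z) hf)
        map_d := fun {Y Z} f => F.map_injective (by
          rw [hR, IsDGFunctor.map_d, hR, d_conj (hi Y) (hi' Z)]) }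
    unit_closed := fun X => hclosed _ (by
      rw [hunit]
      exact hi' _)
    counit_closed := fun Y => hi Y }⟩

end Criterion

/-! ### Dg-pairings and the tensor-hom adjunction -/

namespace DGBimod

variable {K : Type w} [CommRing K] {U : DGAlg.{w, u₂} K} {T : DGAlg.{w, u₁} K}

/-- A dg-pairing `N × A → B`: a bilinear map of degree zero that is `T`-balanced, `U`-linear and
satisfies the Leibniz rule. Equivalently, a closed morphism `N ⊗_T A → B` of degree zero. -/
structure IsDGPairing (N : DGBimod.{w, u₁, u₂, v} U T) {A : DGMod.{w, u₁, v} T}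
    {B : DGMod.{w, u₂, v} U} (P : N →ₗ[K] A →ₗ[K] B) : Prop where
  mem : ∀ {i j : ℤ} {m : N} {a : A}, m ∈ N.gr i → a ∈ A.gr j → P m a ∈ B.gr (i + j)
  smul_left : ∀ (u : U) (m : N) (a : A), P (u • m) a = u • P m a
  balanced : ∀ (t : T) (m : N) (a : A), P (MulOpposite.op t • m) a = P m (t • a)
  d_apply : ∀ {i : ℤ} {m : N}, m ∈ N.gr i → ∀ a : A,
    B.d (P m a) = P (N.d m) a + i.negOnePow • P m (A.d a)

/-- The pairing `(m, a) ↦ (-1) ^ (|m| |a|) f(a)(m)` of a morphism `f : A → Hom_U(N, B)`. -/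
def pairing (N : DGBimod.{w, u₁, u₂, v} U T) {A : DGMod.{w, u₁, v} T} {B : DGMod.{w, u₂, v} U}
    (f : A ⟶ N.homFunctor.obj B) : N →ₗ[K] A →ₗ[K] B :=
  koszulFlip A.isInternal N.isInternal ((DGMod.homTotal N.toDGMod B).subtype ∘ₗ f.1)

theorem pairing_of_mem (N : DGBimod.{w, u₁, u₂, v} U T) {A : DGMod.{w, u₁, v} T}
    {B : DGMod.{w, u₂, v} U} (f : A ⟶ N.homFunctor.obj B) {i j : ℤ} {m : N} {a : A}
    (hm : m ∈ N.gr i) (ha : a ∈ A.gr j) :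
    N.pairing f m a = (i * j).negOnePow • (f.1 a).1 m := by
  rw [pairing, koszulFlip_of_mem _ _ _ ha hm, mul_comm]
  rfl

theorem val_mem_homDeg {N : DGBimod.{w, u₁, u₂, v} U T} {A : DGMod.{w, u₁, v} T}
    {B : DGMod.{w, u₂, v} U} {f : A ⟶ N.homFunctor.obj B}
    (hf : DGCategory.IsClosedZero K f) {j : ℤ} {a : A} (ha : a ∈ A.gr j) :
    (f.1 a).1 ∈ DGMod.homDeg N.toDGMod B j := by
  have := hf.1.1 j a ha
  rwa [add_zero] at this

/-- A morphism that is closed of degree zero intertwines the differentials. -/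
theorem _root_.DGMod.map_d_of_isClosedZero {R : DGAlg.{w, u} K} {A B : DGMod.{w, u, v} R}
    {f : A ⟶ B} (hf : DGCategory.IsClosedZero K f) (a : A) : f.1 (A.d a) = B.d (f.1 a) := by
  have h := LinearMap.congr_fun (congrArg Subtype.val hf.2) a
  have h' := LinearMap.congr_fun (DGMod.homD_of_mem f hf.1) a
  have h'' := h'.symm.trans h
  rw [Int.negOnePow_zero, one_smul] at h''
  exact (sub_eq_zero.mp h'').symm

theorem _root_.DGMod.map_smul_of_isClosedZero {R : DGAlg.{w, u} K} {A B : DGMod.{w, u, v} R}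
    {f : A ⟶ B} (hf : DGCategory.IsClosedZero K f) (r : R) (a : A) :
    f.1 (r • a) = r • f.1 a := by
  refine gradedInduction R.isInternal r (fun i r hr => ?_) (fun r s hr hs => ?_)
  · have := hf.1.2 i r hr a
    rw [zero_mul, Int.negOnePow_zero, one_smul] at this
    exact this.symm
  · rw [add_smul, add_smul, map_add, hr, hs]

/-- Balancedness is where the sign `(-1) ^ (|t| (|η| + |m|))` of the `T`-action on `Hom_U(N, B)`
is needed: it is absorbed by the Koszul sign in the definition of the pairing. -/
theorem isDGPairing_pairing (N : DGBimod.{w, u₁, u₂, v} U T) {A : DGMod.{w, u₁, v} T}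
    {B : DGMod.{w, u₂, v} U} {f : A ⟶ N.homFunctor.obj B}
    (hf : DGCategory.IsClosedZero K f) : N.IsDGPairing (N.pairing f) where
  mem {i j m a} hm ha := by
    rw [N.pairing_of_mem f hm ha]
    exact negOnePow_smul_mem _ _ ((val_mem_homDeg hf ha).1 _ _ hm)
  smul_left u m a := by
    refine gradedInduction U.isInternal u (fun k u hu => ?_) fun u u' h h' => by
      simp only [add_smul, map_add, LinearMap.add_apply, h, h']
    refine gradedInduction N.isInternal m (fun i m hm => ?_) fun m m' h h' => by
      simp only [smul_add, map_add, LinearMap.add_apply, h, h']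
    refine gradedInduction A.isInternal a (fun j a ha => ?_) fun a a' h h' => by
      simp only [smul_add, map_add, h, h']
    rw [N.pairing_of_mem f hm ha, N.pairing_of_mem f (N.smul_mem hu hm) ha,
      DGMod.negOnePow_smul_comm, (val_mem_homDeg hf ha).2 k u hu, smul_smul,
      ← Int.negOnePow_add]
    congr 2
    ring
  balanced t m a := by
    refine gradedInduction T.isInternal t (fun k t ht => ?_) fun t t' h h' => by
      simp only [MulOpposite.op_add, add_smul, map_add, LinearMap.add_apply, h, h']
    refine gradedInduction N.isInternal m (fun i m hm => ?_) fun m m' h h' => by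
      simp only [smul_add, map_add, LinearMap.add_apply, h, h']
    refine gradedInduction A.isInternal a (fun j a ha => ?_) fun a a' h h' => by
      simp only [smul_add, map_add, h, h']
    rw [N.pairing_of_mem f (N.rsmul_mem hm ht) ha, N.pairing_of_mem f hm (A.smul_mem ht ha),
      DGMod.map_smul_of_isClosedZero hf]
    change _ = _ • N.act B t (f.1 a) m
    rw [act_of_mem ht (val_mem_homDeg hf ha) hm, smul_smul, ← Int.negOnePow_add]
    congr 1
    rw [Int.negOnePow_eq_iff]
    exact ⟨-(i * k), by ring⟩
  d_apply {i m} hm a := by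
    refine gradedInduction A.isInternal a (fun j a ha => ?_) fun a a' h h' => by
      simp only [smul_add, map_add, h, h']; abel
    have hd : (f.1 (A.d a)).1 m = B.d ((f.1 a).1 m) - j.negOnePow • (f.1 a).1 (N.d m) := by
      rw [DGMod.map_d_of_isClosedZero hf a]
      exact LinearMap.congr_fun (DGMod.homD_of_mem (f.1 a) (val_mem_homDeg hf ha)) m
    rw [N.pairing_of_mem f hm ha, N.pairing_of_mem f (N.d_mem hm) ha,
      N.pairing_of_mem f hm (A.d_mem ha), hd, map_negOnePow_smul]
    simp only [mul_add, add_mul, mul_one, one_mul, Int.negOnePow_add, smul_sub, smul_smul]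
    rcases Int.units_eq_one_or i.negOnePow with h | h <;> rw [h] <;> simp

/-- Every dg-pairing `N × A → B` comes from a closed morphism `A → Hom_U(N, B)` of degree zero. -/
theorem IsDGPairing.exists_closed {N : DGBimod.{w, u₁, u₂, v} U T} {A : DGMod.{w, u₁, v} T}
    {B : DGMod.{w, u₂, v} U} {P : N →ₗ[K] A →ₗ[K] B} (hP : N.IsDGPairing P) :
    ∃ f : A ⟶ N.homFunctor.obj B, DGCategory.IsClosedZero K f ∧ N.pairing f = P := by
  -- `f(a)(m) = (-1) ^ (|m| |a|) P(m, a)`; the flip with the Koszul sign is its own inverse.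
  let φ : A →ₗ[K] N →ₗ[K] B := koszulFlip N.isInternal A.isInternal P
  have hφ : ∀ {i j : ℤ} {m : N} {a : A}, m ∈ N.gr i → a ∈ A.gr j →
      φ a m = (i * j).negOnePow • P m a := fun hm ha => koszulFlip_of_mem _ _ _ hm ha
  have hdeg : ∀ {j : ℤ} {a : A}, a ∈ A.gr j → φ a ∈ DGMod.homDeg N.toDGMod B j := by
    intro j a ha
    refine ⟨fun i m hm => ?_, fun k u hu m => ?_⟩
    · rw [hφ hm ha]
      exact negOnePow_smul_mem _ _ (hP.mem hm ha)
    · refine gradedInduction N.isInternal m (fun i m hm => ?_) fun m m' h h' => by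
        simp only [smul_add, map_add, h, h']
      rw [hφ hm ha, hφ (N.smul_mem hu hm) ha, hP.smul_left, DGMod.negOnePow_smul_comm, smul_smul,
        ← Int.negOnePow_add]
      congr 1
      rw [Int.negOnePow_eq_iff]
      exact ⟨-(k * j), by ring⟩
  let f₀ : A →ₗ[K] DGMod.homTotal N.toDGMod B := φ.codRestrict _ fun a =>
    gradedInduction A.isInternal a (fun j a ha => DGMod.homDeg_le _ _ _ (hdeg ha))
      fun a a' h h' => by
        rw [map_add]
        exact add_mem h h'
  have hf₀ : f₀ ∈ DGMod.homDeg A (N.homObj B) 0 := by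
    refine ⟨fun j a ha => ?_, fun k t ht a => ?_⟩
    · rw [add_zero]
      exact hdeg ha
    · rw [zero_mul, Int.negOnePow_zero, one_smul]
      refine gradedInduction A.isInternal a (fun j a ha => ?_) fun a a' h h' => by
        simp only [smul_add, map_add, h, h']
      refine DGMod.homTotal_ext fun m => ?_
      change N.act B t (f₀ a) m = φ (t • a) m
      refine gradedInduction N.isInternal m (fun i m hm => ?_) fun m m' h h' => by
        simp only [map_add, h, h']
      rw [act_of_mem ht (η := f₀ a) (hdeg ha) hm]
      change _ • φ a _ = _
      rw [hφ (N.rsmul_mem hm ht) ha, hφ hm (A.smul_mem ht ha), hP.balanced, smul_smul,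
        ← Int.negOnePow_add]
      congr 1
      rw [Int.negOnePow_eq_iff]
      exact ⟨k * j, by ring⟩
  let f : A ⟶ N.homFunctor.obj B := ⟨f₀, DGMod.homDeg_le _ _ _ hf₀⟩
  refine ⟨f, ⟨hf₀, ?_⟩, koszulFlip_koszulFlip _ _ P⟩
  refine DGMod.homTotal_ext fun a => ?_
  refine (LinearMap.congr_fun (DGMod.homD_of_mem f hf₀) a).trans ?_
  refine DGMod.homTotal_ext fun m => ?_
  rw [Int.negOnePow_zero, one_smul]
  change (DGMod.homD N.toDGMod B (f₀ a)).1 m - φ (A.d a) m = 0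
  refine gradedInduction A.isInternal a (fun j a ha => ?_) fun a a' h h' => by
    rw [map_add f₀, map_add (DGMod.homD _ _), DGMod.homTotal_add_apply, map_add A.d, map_add φ,
      LinearMap.add_apply, add_sub_add_comm, h, h', add_zero]
  rw [DGMod.homD_of_mem (f₀ a) (hdeg ha)]
  change B.d (φ a m) - j.negOnePow • φ a (N.d m) - φ (A.d a) m = 0
  refine gradedInduction N.isInternal m (fun i m hm => ?_) fun m m' h h' => by
    rw [← add_zero (0 : B), ← h]
    nth_rw 2 [h]
    rw [← h']
    simp only [map_add, smul_add]
    abel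
  rw [hφ hm ha, hφ (N.d_mem hm) ha, hφ hm (A.d_mem ha), map_negOnePow_smul, hP.d_apply hm]
  simp only [mul_add, add_mul, mul_one, one_mul, Int.negOnePow_add, smul_add, smul_smul]
  rw [mul_comm j.negOnePow]
  have := Int.units_mul_self j.negOnePow
  rw [mul_assoc, this, mul_one]
  abel

end DGBimod

/-! ### The algebra of triangular matrices -/

namespace DGBimod

variable {K : Type w} [CommRing K] {U : DGAlg.{w, u₂} K} {T : DGAlg.{w, u₁} K}

/-- The ring of triangular matrices `[[t, 0], [m, u]]`, written as triples `(t, m, u)`. Since `N`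
has no multiplication, this does not compete with a ring structure on a product. -/
@[reducible] def triangularRing (N : DGBimod.{w, u₁, u₂, v} U T) : Ring (T × N × U) :=
  { (inferInstance : AddCommGroup (T × N × U)) with
    one := (1, 0, 1)
    mul := fun x y =>
      (x.1 * y.1, MulOpposite.op y.1 • x.2.1 + x.2.2 • y.2.1, x.2.2 * y.2.2)
    left_distrib := fun x y z => Prod.ext (mul_add _ _ _) (Prod.ext (by
      change MulOpposite.op (y.1 + z.1) • x.2.1 + x.2.2 • (y.2.1 + z.2.1) =
        (MulOpposite.op y.1 • x.2.1 + x.2.2 • y.2.1) +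
          (MulOpposite.op z.1 • x.2.1 + x.2.2 • z.2.1)
      rw [MulOpposite.op_add, add_smul, smul_add]
      abel) (mul_add _ _ _))
    right_distrib := fun x y z => Prod.ext (add_mul _ _ _) (Prod.ext (by
      change MulOpposite.op z.1 • (x.2.1 + y.2.1) + (x.2.2 + y.2.2) • z.2.1 =
        (MulOpposite.op z.1 • x.2.1 + x.2.2 • z.2.1) +
          (MulOpposite.op z.1 • y.2.1 + y.2.2 • z.2.1)
      rw [add_smul, smul_add]
      abel) (add_mul _ _ _))
    zero_mul := fun x => Prod.ext (zero_mul _) (Prod.ext (by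
      change MulOpposite.op x.1 • (0 : N) + (0 : U) • x.2.1 = 0
      rw [smul_zero, zero_smul, add_zero]) (zero_mul _))
    mul_zero := fun x => Prod.ext (mul_zero _) (Prod.ext (by
      change MulOpposite.op (0 : T) • x.2.1 + x.2.2 • (0 : N) = 0
      rw [MulOpposite.op_zero, smul_zero, zero_smul, add_zero]) (mul_zero _))
    one_mul := fun x => Prod.ext (one_mul _) (Prod.ext (by
      change MulOpposite.op x.1 • (0 : N) + (1 : U) • x.2.1 = x.2.1
      rw [smul_zero, one_smul, zero_add]) (one_mul _))
    mul_one := fun x => Prod.ext (mul_one _) (Prod.ext (by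
      change MulOpposite.op (1 : T) • x.2.1 + x.2.2 • (0 : N) = x.2.1
      rw [MulOpposite.op_one, smul_zero, one_smul, add_zero]) (mul_one _))
    mul_assoc := fun x y z => Prod.ext (mul_assoc _ _ _) (Prod.ext (by
      change MulOpposite.op z.1 • (MulOpposite.op y.1 • x.2.1 + x.2.2 • y.2.1) +
          (x.2.2 * y.2.2) • z.2.1 =
        MulOpposite.op (y.1 * z.1) • x.2.1 +
          x.2.2 • (MulOpposite.op z.1 • y.2.1 + y.2.2 • z.2.1)
      rw [MulOpposite.op_mul, mul_smul, mul_smul, smul_add, smul_add,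
        smul_comm x.2.2 (MulOpposite.op z.1) y.2.1]
      abel) (mul_assoc _ _ _)) }

attribute [local instance] triangularRing

/-- The `K`-algebra of triangular matrices. -/
@[reducible] def triangularAlgebra (N : DGBimod.{w, u₁, u₂, v} U T) : Algebra K (T × N × U) :=
  Algebra.ofModule
    (fun k x y => Prod.ext (smul_mul_assoc k x.1 y.1) (Prod.ext (by
      change MulOpposite.op y.1 • (k • x.2.1) + (k • x.2.2) • y.2.1 =
        k • (MulOpposite.op y.1 • x.2.1 + x.2.2 • y.2.1)
      rw [smul_add, smul_assoc, ← rmul_apply, map_smul, rmul_apply])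
      (smul_mul_assoc k x.2.2 y.2.2)))
    (fun k x y => Prod.ext (mul_smul_comm k x.1 y.1) (Prod.ext (by
      change MulOpposite.op (k • y.1) • x.2.1 + x.2.2 • (k • y.2.1) =
        k • (MulOpposite.op y.1 • x.2.1 + x.2.2 • y.2.1)
      rw [smul_add, MulOpposite.op_smul, smul_assoc, DGMod.smul_comm_K N.toDGMod])
      (mul_smul_comm k x.2.2 y.2.2)))

attribute [local instance] triangularAlgebra

/-- The dg-algebra of triangular matrices, with the entrywise grading and differential. -/
def triangularDGAlg (N : DGBimod.{w, u₁, u₂, v} U T) : DGAlg.{w, max u₁ u₂ v} K where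
  carrier := T × N × U
  gr n := (T.gr n).prod ((N.gr n).prod (U.gr n))
  gradedMonoid :=
    { one_mem := ⟨SetLike.GradedOne.one_mem, zero_mem (N.gr 0), SetLike.GradedOne.one_mem⟩
      mul_mem := fun i j x y hx hy => ⟨SetLike.GradedMul.mul_mem hx.1 hy.1,
        add_mem (N.rsmul_mem hx.2.1 hy.1) (N.smul_mem hx.2.2 hy.2.1),
        SetLike.GradedMul.mul_mem hx.2.2 hy.2.2⟩ }
  isInternal := isInternal_prod T.isInternal (isInternal_prod N.isInternal U.isInternal)
  d := T.d.prodMap (N.d.prodMap U.d)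
  d_mem := fun hx => ⟨T.d_mem hx.1, N.d_mem hx.2.1, U.d_mem hx.2.2⟩
  d_d := fun x => Prod.ext (T.d_d _) (Prod.ext (N.d_d _) (U.d_d _))
  d_mul := fun {n x} hx y => Prod.ext (T.d_mul hx.1 y.1) (Prod.ext (by
      change N.d (MulOpposite.op y.1 • x.2.1 + x.2.2 • y.2.1) =
        (MulOpposite.op y.1 • N.d x.2.1 + U.d x.2.2 • y.2.1) +
        n.negOnePow • (MulOpposite.op (T.d y.1) • x.2.1 + x.2.2 • N.d y.2.1)
      rw [map_add, N.d_rsmul hx.2.1, N.d_smul hx.2.2, smul_add]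
      abel)
    (U.d_mul hx.2.2 y.2.2))

theorem nonempty_triangularMatrixAlgebra (N : DGBimod.{w, u₁, u₂, v} U T) :
    Nonempty (N.TriangularMatrixAlgebra N.triangularDGAlg) :=
  ⟨{ entries := LinearEquiv.refl K (T × N × U)
     entries_one := rfl
     entries_mul := fun _ _ => rfl
     mem_gr_iff := fun _ _ => Iff.rfl
     entries_d := fun _ => rfl }⟩

end DGBimod

/-! ### From the comma category to modules over the triangular algebra -/

namespace DGBimod

variable {K : Type w} [CommRing K] {U : DGAlg.{w, u₂} K} {T : DGAlg.{w, u₁} K}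
  {N : DGBimod.{w, u₁, u₂, v} U T} {Λ : DGAlg.{w, u} K}

namespace TriangularMatrixAlgebra

variable (h : N.TriangularMatrixAlgebra Λ)

section Glue

variable {A : DGMod.{w, u₁, v} T} {B : DGMod.{w, u₂, v} U} {P : N →ₗ[K] A →ₗ[K] B}

/-- The column vectors `(a, b)` as a module over the triangular matrices:
`[[t, 0], [m, u]] (a, b) = (t a, P(m, a) + u b)`. -/
@[reducible] def columnModule (hP : N.IsDGPairing P) : Module Λ (A × B) where
  smul x p := ((h.entries x).1 • p.1, P (h.entries x).2.1 p.1 + (h.entries x).2.2 • p.2)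
  one_smul p := Prod.ext
    (by change (h.entries 1).1 • p.1 = p.1; rw [h.entries_one, one_smul])
    (by
      change P (h.entries 1).2.1 p.1 + (h.entries 1).2.2 • p.2 = p.2
      rw [h.entries_one, map_zero, LinearMap.zero_apply, zero_add, one_smul])
  mul_smul x y p := Prod.ext
    (by
      change (h.entries (x * y)).1 • p.1 = (h.entries x).1 • (h.entries y).1 • p.1
      rw [h.entries_mul, mul_smul])
    (by
      change P (h.entries (x * y)).2.1 p.1 + (h.entries (x * y)).2.2 • p.2 =
        P (h.entries x).2.1 ((h.entries y).1 • p.1) +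
          (h.entries x).2.2 • (P (h.entries y).2.1 p.1 + (h.entries y).2.2 • p.2)
      rw [h.entries_mul, map_add, LinearMap.add_apply, hP.balanced, hP.smul_left, mul_smul,
        smul_add, add_assoc])
  smul_zero x := Prod.ext (smul_zero _)
    (by
      change P (h.entries x).2.1 0 + (h.entries x).2.2 • (0 : B) = 0
      rw [map_zero, smul_zero, add_zero])
  smul_add x p q := Prod.ext (smul_add _ _ _)
    (by
      change P (h.entries x).2.1 (p.1 + q.1) + (h.entries x).2.2 • (p.2 + q.2) =
        (P (h.entries x).2.1 p.1 + (h.entries x).2.2 • p.2) +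
          (P (h.entries x).2.1 q.1 + (h.entries x).2.2 • q.2)
      rw [map_add, smul_add]
      abel)
  add_smul x y p := Prod.ext
    (by
      change (h.entries (x + y)).1 • p.1 = (h.entries x).1 • p.1 + (h.entries y).1 • p.1
      rw [map_add, Prod.fst_add, add_smul])
    (by
      change P (h.entries (x + y)).2.1 p.1 + (h.entries (x + y)).2.2 • p.2 =
        (P (h.entries x).2.1 p.1 + (h.entries x).2.2 • p.2) +
          (P (h.entries y).2.1 p.1 + (h.entries y).2.2 • p.2)
      rw [map_add, Prod.snd_add, Prod.fst_add, Prod.snd_add, map_add, LinearMap.add_apply,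
        add_smul]
      abel)
  zero_smul p := Prod.ext
    (by
      change (h.entries 0).1 • p.1 = 0
      rw [map_zero, Prod.fst_zero, zero_smul])
    (by
      change P (h.entries 0).2.1 p.1 + (h.entries 0).2.2 • p.2 = 0
      rw [map_zero, Prod.snd_zero, Prod.fst_zero, Prod.snd_zero, map_zero, LinearMap.zero_apply,
        zero_smul, add_zero])

/-- The dg-module of column vectors `(a, b)` over the triangular matrices, for a dg-pairing
`P : N × A → B`. -/
def column (hP : N.IsDGPairing P) : DGMod.{w, u, v} Λ where
  carrier := A × B
  gr n := (A.gr n).prod (B.gr n)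
  isInternal := isInternal_prod A.isInternal B.isInternal
  d := A.d.prodMap B.d
  d_mem := fun hx => ⟨A.d_mem hx.1, B.d_mem hx.2⟩
  d_d := fun x => Prod.ext (A.d_d _) (B.d_d _)
  module := h.columnModule hP
  isScalarTower := by
    let := h.columnModule hP
    exact ⟨fun k x p => Prod.ext
      (by
        change (h.entries (k • x)).1 • p.1 = k • (h.entries x).1 • p.1
        rw [map_smul, Prod.smul_fst, smul_assoc])
      (by
        change P (h.entries (k • x)).2.1 p.1 + (h.entries (k • x)).2.2 • p.2 =
          k • (P (h.entries x).2.1 p.1 + (h.entries x).2.2 • p.2)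
        rw [map_smul, Prod.smul_snd, Prod.smul_fst, Prod.smul_snd, map_smul,
          LinearMap.smul_apply, smul_assoc, smul_add])⟩
  smul_mem := fun {i j x p} hx hp => by
    obtain ⟨h₁, h₂, h₃⟩ := (h.mem_gr_iff i x).1 hx
    exact ⟨A.smul_mem h₁ hp.1, add_mem (hP.mem h₂ hp.1) (B.smul_mem h₃ hp.2)⟩
  d_smul := fun {i x} hx p => by
    obtain ⟨h₁, h₂, h₃⟩ := (h.mem_gr_iff i x).1 hx
    refine Prod.ext ?_ ?_
    · change A.d ((h.entries x).1 • p.1) = (h.entries (Λ.d x)).1 • p.1 +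
        i.negOnePow • ((h.entries x).1 • A.d p.1)
      rw [h.entries_d, A.d_smul h₁]
    · change B.d (P (h.entries x).2.1 p.1 + (h.entries x).2.2 • p.2) =
        (P (h.entries (Λ.d x)).2.1 p.1 + (h.entries (Λ.d x)).2.2 • p.2) +
        i.negOnePow • (P (h.entries x).2.1 (A.d p.1) + (h.entries x).2.2 • B.d p.2)
      rw [h.entries_d, map_add, hP.d_apply h₂, B.d_smul h₃, smul_add]
      abel

theorem mem_gr_of_entries {n : ℤ} {t : T} {m : N} {u : U} (ht : t ∈ T.gr n) (hm : m ∈ N.gr n)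
    (hu : u ∈ U.gr n) : h.entries.symm (t, m, u) ∈ Λ.gr n := by
  rw [h.mem_gr_iff, LinearEquiv.apply_symm_apply]
  exact ⟨ht, hm, hu⟩

variable {A' : DGMod.{w, u₁, v} T} {B' : DGMod.{w, u₂, v} U} {P' : N →ₗ[K] A' →ₗ[K] B'}

/-- The morphisms of degree `n` between column modules, spelled out in matrix entries. -/
theorem mem_homDeg_column_iff (hP : N.IsDGPairing P) (hP' : N.IsDGPairing P') (n : ℤ)
    (γ : A × B →ₗ[K] A' × B') :
    γ ∈ DGMod.homDeg (h.column hP) (h.column hP') n ↔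
      (∀ i, ∀ a ∈ A.gr i, ∀ b ∈ B.gr i,
        (γ (a, b)).1 ∈ A'.gr (i + n) ∧ (γ (a, b)).2 ∈ B'.gr (i + n)) ∧
      ∀ i, ∀ t ∈ T.gr i, ∀ m ∈ N.gr i, ∀ u ∈ U.gr i, ∀ a b,
        (t • (γ (a, b)).1, P' m (γ (a, b)).1 + u • (γ (a, b)).2) =
          (n * i).negOnePow • γ (t • a, P m a + u • b) := by
  constructor
  · rintro ⟨h₁, h₂⟩
    refine ⟨fun i a ha b hb => h₁ i (a, b) ⟨ha, hb⟩, fun i t ht m hm u hu a b => ?_⟩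
    have := h₂ i _ (h.mem_gr_of_entries ht hm hu) (a, b)
    change ((h.entries _).1 • (γ (a, b)).1,
      P' (h.entries _).2.1 (γ (a, b)).1 + (h.entries _).2.2 • (γ (a, b)).2) =
      (n * i).negOnePow •
        γ ((h.entries _).1 • a, P (h.entries _).2.1 a + (h.entries _).2.2 • b) at this
    rwa [LinearEquiv.apply_symm_apply] at this
  · rintro ⟨h₁, h₂⟩
    refine ⟨fun i p hp => h₁ i p.1 hp.1 p.2 hp.2, fun i x hx p => ?_⟩
    obtain ⟨ht, hm, hu⟩ := (h.mem_gr_iff i x).1 hx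
    exact h₂ i _ ht _ hm _ hu p.1 p.2

/-- The pairs `(α, β)` of linear maps that give `Λ`-linear maps of degree `n` between column
modules: `α` and `β` are linear of degree `n` over `T` and `U`, and they are compatible with the
pairings up to the Koszul sign. -/
theorem prodMap_mem_homDeg_iff (hP : N.IsDGPairing P) (hP' : N.IsDGPairing P') (n : ℤ)
    (α : A →ₗ[K] A') (β : B →ₗ[K] B') :
    α.prodMap β ∈ DGMod.homDeg (h.column hP) (h.column hP') n ↔
      α ∈ DGMod.homDeg A A' n ∧ β ∈ DGMod.homDeg B B' n ∧
        ∀ i, ∀ m ∈ N.gr i, ∀ a, P' m (α a) = (n * i).negOnePow • β (P m a) := by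
  refine (h.mem_homDeg_column_iff hP hP' n (α.prodMap β)).trans ⟨?_, ?_⟩
  · rintro ⟨h₁, h₂⟩
    refine ⟨⟨fun i a ha => (h₁ i a ha 0 (zero_mem _)).1, fun i t ht a => ?_⟩,
      ⟨fun i b hb => (h₁ i 0 (zero_mem _) b hb).2, fun i u hu b => ?_⟩, fun i m hm a => ?_⟩
    · exact congrArg Prod.fst (h₂ i t ht 0 (zero_mem _) 0 (zero_mem _) a 0)
    · simpa using congrArg Prod.snd (h₂ i 0 (zero_mem _) 0 (zero_mem _) u hu 0 b)
    · simpa using congrArg Prod.snd (h₂ i 0 (zero_mem _) m hm 0 (zero_mem _) a 0)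
  · rintro ⟨hα, hβ, hc⟩
    refine ⟨fun i a ha b hb => ⟨hα.1 i a ha, hβ.1 i b hb⟩,
      fun i t ht m hm u hu a b => Prod.ext (hα.2 i t ht a) ?_⟩
    change P' m (α a) + u • β b = (n * i).negOnePow • β (P m a + u • b)
    rw [hc i m hm, hβ.2 i u hu, map_add, smul_add]

/-- A homogeneous `Λ`-linear map between column modules is diagonal, since it commutes with the
two idempotents `(1, 0, 0)` and `(0, 0, 1)`. -/
theorem exists_eq_prodMap (hP : N.IsDGPairing P) (hP' : N.IsDGPairing P') {n : ℤ}
    (γ : A × B →ₗ[K] A' × B') (hγ : γ ∈ DGMod.homDeg (h.column hP) (h.column hP') n) :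
    ∃ (α : A →ₗ[K] A') (β : B →ₗ[K] B'), γ = α.prodMap β := by
  have hs := ((h.mem_homDeg_column_iff hP hP' n γ).1 hγ).2
  have h₁ : ∀ a : A, (γ (a, 0)).2 = 0 := fun a => by
    simpa using (congrArg Prod.snd
      (hs 0 1 SetLike.GradedOne.one_mem 0 (zero_mem _) 0 (zero_mem _) a 0)).symm
  have h₂ : ∀ b : B, (γ (0, b)).1 = 0 := fun b => by
    simpa using (congrArg Prod.fst
      (hs 0 0 (zero_mem _) 0 (zero_mem _) 1 SetLike.GradedOne.one_mem 0 b)).symm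
  refine ⟨LinearMap.fst K A' B' ∘ₗ γ ∘ₗ LinearMap.inl K A B,
    LinearMap.snd K A' B' ∘ₗ γ ∘ₗ LinearMap.inr K A B, LinearMap.ext fun p => ?_⟩
  have hp : γ p = γ (p.1, 0) + γ (0, p.2) := by
    rw [← map_add, Prod.mk_add_mk, add_zero, zero_add]
  rw [hp]
  exact Prod.ext (by simp [h₂]) (by simp [h₁])

end Glue

/-- In terms of pairings, the condition `f' ∘ α = G(β) ∘ f` on morphisms of degree `n` of the
comma category reads `P'(m, α a) = (-1) ^ (n |m|) β(P(m, a))`. -/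
theorem _root_.DGBimod.pairing_comp_iff {A A' : DGMod.{w, u₁, v} T} {B B' : DGMod.{w, u₂, v} U}
    (f : A ⟶ N.homFunctor.obj B) (f' : A' ⟶ N.homFunctor.obj B') {n : ℤ} {α : A ⟶ A'}
    {β : B ⟶ B'} (hα : α.1 ∈ DGMod.homDeg A A' n) :
    α ≫ f' = f ≫ N.homFunctor.map β ↔
      ∀ i, ∀ m ∈ N.gr i, ∀ a, N.pairing f' m (α.1 a) =
        (n * i).negOnePow • β.1 (N.pairing f m a) := by
  -- Both sides of the two equations differ by the same sign, as `α a` has degree `|a| + n`.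
  have key : ∀ {i j : ℤ} {m : N} {a : A}, m ∈ N.gr i → a ∈ A.gr j →
      (N.pairing f' m (α.1 a) = (n * i).negOnePow • β.1 (N.pairing f m a) ↔
        ((α ≫ f').1 a).1 m = ((f ≫ N.homFunctor.map β).1 a).1 m) := by
    intro i j m a hm ha
    rw [N.pairing_of_mem f' hm (hα.1 j a ha), N.pairing_of_mem f hm ha, map_negOnePow_smul,
      smul_smul, ← Int.negOnePow_add, show n * i + i * j = i * (j + n) by ring]
    exact (MulAction.injective (i * (j + n)).negOnePow).eq_iff
  constructor
  · intro hc i m hm a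
    refine gradedInduction A.isInternal a (fun j a ha => ?_) fun a a' h h' => by
      simp only [smul_add, map_add, h, h']
    rw [key hm ha, hc]
  · intro hc
    refine DGMod.homTotal_ext fun a => ?_
    refine gradedInduction A.isInternal a (fun j a ha => ?_) fun a a' h h' => by
      rw [map_add, map_add, h, h']
    refine DGMod.homTotal_ext fun m => ?_
    refine gradedInduction N.isInternal m (fun i m hm => ?_) fun m m' h h' => by
      rw [map_add, map_add, h, h']
    exact (key hm ha).1 (hc i m hm a)

/-- The column module of an object `(A, f, B)` of the comma category. -/
abbrev columnObj (X : DGComma K N.homFunctor) : DGMod.{w, u, v} Λ :=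
  h.column (N.isDGPairing_pairing X.hom_closed)

theorem prodMap_mem_homDeg {X Y : DGComma K N.homFunctor} {n : ℤ} {p : X ⟶ Y}
    (hp : p ∈ DGCategory.gr (K := K) X Y n) :
    p.1.1.1.prodMap p.1.2.1 ∈ DGMod.homDeg (h.columnObj X) (h.columnObj Y) n :=
  (h.prodMap_mem_homDeg_iff _ _ n _ _).2
    ⟨hp.1, hp.2, (pairing_comp_iff X.hom Y.hom hp.1).1 p.2⟩

theorem prodMap_mem_homTotal {X Y : DGComma K N.homFunctor} (p : X ⟶ Y) :
    p.1.1.1.prodMap p.1.2.1 ∈ DGMod.homTotal (h.columnObj X) (h.columnObj Y) :=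
  gradedInduction (DGCategory.isInternal (K := K) X Y) p
    (fun n p hp => DGMod.homDeg_le _ _ _ (h.prodMap_mem_homDeg hp))
    fun p q hp hq => add_mem hp hq

/-- The functor that sends `(A, f, B)` to the module of column vectors `(a, b)`. -/
def columnFunctor : DGComma K N.homFunctor ⥤ DGMod.{w, u, v} Λ where
  obj X := h.columnObj X
  map p := ⟨p.1.1.1.prodMap p.1.2.1, h.prodMap_mem_homTotal p⟩

instance : IsDGFunctor K h.columnFunctor where
  map_add p q := rfl
  map_smul k p := rfl
  map_mem hp := h.prodMap_mem_homDeg hp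
  map_d {X Y} p := by
    refine gradedInduction (DGCategory.isInternal (K := K) X Y) p (fun n p hp => ?_)
      fun p q hp hq => ?_
    · refine DGMod.homTotal_ext fun x => ?_
      refine Eq.trans ?_
        (LinearMap.congr_fun (DGMod.homD_of_mem _ (h.prodMap_mem_homDeg hp)) x).symm
      exact Prod.ext (LinearMap.congr_fun (DGMod.homD_of_mem p.1.1 hp.1) x.1)
        (LinearMap.congr_fun (DGMod.homD_of_mem p.1.2 hp.2) x.2)
    · have hadd : ∀ p q : X ⟶ Y, h.columnFunctor.map (p + q) =
          h.columnFunctor.map p + h.columnFunctor.map q := fun _ _ => rfl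
      rw [map_add, hadd, hadd, map_add, hp, hq]

instance : h.columnFunctor.Faithful where
  map_injective {X Y p q} hpq := by
    have hv : ∀ x, p.1.1.1.prodMap p.1.2.1 x = q.1.1.1.prodMap q.1.2.1 x := fun x =>
      LinearMap.congr_fun (congrArg Subtype.val hpq) x
    exact Subtype.ext (Prod.ext
      (DGMod.homTotal_ext fun a => congrArg Prod.fst (hv (a, 0)))
      (DGMod.homTotal_ext fun b => congrArg Prod.snd (hv (0, b))))

theorem exists_columnFunctor_map_eq {X Y : DGComma K N.homFunctor} {n : ℤ}
    (γ : h.columnFunctor.obj X ⟶ h.columnFunctor.obj Y)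
    (hγ : γ ∈ DGCategory.gr (K := K) (h.columnFunctor.obj X) (h.columnFunctor.obj Y) n) :
    ∃ p ∈ DGCategory.gr (K := K) X Y n, h.columnFunctor.map p = γ := by
  have hγ' : γ.1 ∈ DGMod.homDeg (h.columnObj X) (h.columnObj Y) n := hγ
  obtain ⟨α, β, hαβ⟩ := h.exists_eq_prodMap (N.isDGPairing_pairing X.hom_closed)
    (N.isDGPairing_pairing Y.hom_closed) γ.1 hγ'
  rw [hαβ] at hγ'
  obtain ⟨hα, hβ, hc⟩ := (h.prodMap_mem_homDeg_iff _ _ n α β).1 hγ'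
  let α' : X.left ⟶ Y.left := ⟨α, DGMod.homDeg_le _ _ _ hα⟩
  let β' : X.right ⟶ Y.right := ⟨β, DGMod.homDeg_le _ _ _ hβ⟩
  exact ⟨⟨(α', β'), (pairing_comp_iff (α := α') (β := β') X.hom Y.hom hα).2 hc⟩, ⟨hα, hβ⟩,
    Subtype.ext hαβ.symm⟩

end TriangularMatrixAlgebra

end DGBimod

/-! ### Splitting a module over the triangular algebra -/

theorem DGAlg.d_one {K : Type w} [CommRing K] (A : DGAlg.{w, u} K) : A.d 1 = 0 := by
  have := A.d_mul (SetLike.GradedOne.one_mem (A := A.gr)) 1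
  simpa using this

/-- A non-unital homomorphism of dg-`K`-algebras: it sends `1` to an idempotent that need not
be `1`. -/
structure DGAlg.CornerHom {K : Type w} [CommRing K] (A : DGAlg.{w, u₁} K)
    (Λ : DGAlg.{w, u} K) where
  toFun : A →ₗ[K] Λ
  map_mul : ∀ a b, toFun (a * b) = toFun a * toFun b
  map_mem : ∀ {n : ℤ} {a : A}, a ∈ A.gr n → toFun a ∈ Λ.gr n
  map_d : ∀ a, toFun (A.d a) = Λ.d (toFun a)

namespace DGAlg.CornerHom

variable {K : Type w} [CommRing K] {A : DGAlg.{w, u₁} K} {Λ : DGAlg.{w, u} K}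
  (φ : A.CornerHom Λ) (M : DGMod.{w, u, v} Λ)

theorem one_smul_smul (a : A) (x : M) : φ.toFun 1 • φ.toFun a • x = φ.toFun a • x := by
  rw [smul_smul, ← φ.map_mul, one_mul]

theorem one_smul_mem {n : ℤ} {x : M} (hx : x ∈ M.gr n) : φ.toFun 1 • x ∈ M.gr n := by
  have := M.smul_mem (φ.map_mem (SetLike.GradedOne.one_mem (A := A.gr))) hx
  rwa [zero_add] at this

/-- The idempotent `φ 1` is closed of degree zero, so that it commutes with the differential. -/
theorem d_one_smul (x : M) : M.d (φ.toFun 1 • x) = φ.toFun 1 • M.d x := by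
  rw [M.d_smul (φ.map_mem (SetLike.GradedOne.one_mem (A := A.gr))), ← φ.map_d, A.d_one]
  simp

/-- The fixed points `e M` of the idempotent `e = φ 1`. -/
def fixedPoints : Submodule K M where
  carrier := {x | φ.toFun 1 • x = x}
  zero_mem' := smul_zero _
  add_mem' := fun {x y} (hx : _ = _) (hy : _ = _) => by
    change _ • (x + y) = x + y
    rw [smul_add, hx, hy]
  smul_mem' := fun k x (hx : _ = _) => by
    change _ • (k • x) = k • x
    rw [DGMod.smul_comm_K, hx]

theorem smul_mem_fixedPoints (a : A) (x : M) : φ.toFun a • x ∈ φ.fixedPoints M :=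
  φ.one_smul_smul M a x

/-- The fixed points `e M` as an `A`-module; it is unital because `1 ∈ A` acts as `e`. -/
@[reducible] def cornerModule : Module A (φ.fixedPoints M) where
  smul a x := ⟨φ.toFun a • x.1, φ.smul_mem_fixedPoints M a x.1⟩
  one_smul x := Subtype.ext x.2
  mul_smul a b x := Subtype.ext (by
    change φ.toFun (a * b) • x.1 = φ.toFun a • φ.toFun b • x.1
    rw [φ.map_mul, mul_smul])
  smul_zero a := Subtype.ext (smul_zero _)
  smul_add a x y := Subtype.ext (smul_add _ _ _)
  add_smul a b x := Subtype.ext (by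
    change φ.toFun (a + b) • x.1 = φ.toFun a • x.1 + φ.toFun b • x.1
    rw [map_add, add_smul])
  zero_smul x := Subtype.ext (by
    change φ.toFun 0 • x.1 = 0
    rw [map_zero, zero_smul])

/-- The dg-`A`-module `e M` of a dg-`Λ`-module `M`, where `e = φ 1`. -/
def corner : DGMod.{w, u₁, v} A where
  carrier := φ.fixedPoints M
  gr n := (M.gr n).comap (φ.fixedPoints M).subtype
  isInternal := isInternal_comap M.isInternal.submodule_iSupIndep _ (by
    intro x hx
    have h : ∀ x : M, φ.toFun 1 • x ∈ ⨆ n, M.gr n ⊓ φ.fixedPoints M := fun x =>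
      gradedInduction M.isInternal x
        (fun n x hx => Submodule.mem_iSup_of_mem n
          ⟨φ.one_smul_mem M hx, φ.smul_mem_fixedPoints M 1 x⟩)
        fun x y hx hy => by
          rw [smul_add]
          exact add_mem hx hy
    rw [← show φ.toFun 1 • x = x from hx]
    exact h x)
  d := M.d.restrict fun x (hx : _ = _) => by
    change _ • M.d x = M.d x
    rw [← φ.d_one_smul, hx]
  d_mem := fun hx => M.d_mem hx
  d_d := fun x => Subtype.ext (M.d_d x.1)
  module := φ.cornerModule M
  isScalarTower := by
    let := φ.cornerModule M
    exact ⟨fun k a x => Subtype.ext (by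
      change φ.toFun (k • a) • x.1 = k • φ.toFun a • x.1
      rw [map_smul, smul_assoc])⟩
  smul_mem := fun ha hx => M.smul_mem (φ.map_mem ha) hx
  d_smul := fun {i a} ha x => Subtype.ext (by
    change M.d (φ.toFun a • x.1) = φ.toFun (A.d a) • x.1 + i.negOnePow • (φ.toFun a • M.d x.1)
    rw [M.d_smul (φ.map_mem ha), φ.map_d])

end DGAlg.CornerHom

/-- A linear bijection that is compatible with the actions, the gradings and the differentials is
an isomorphism of dg-modules that is closed of degree zero together with its inverse. -/
theorem DGMod.exists_closedIso {K : Type w} [CommRing K] {R : DGAlg.{w, u} K}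
    {M M' : DGMod.{w, u, v} R} (e : M ≃ₗ[K] M') (hgr : ∀ i, ∀ x ∈ M.gr i, e x ∈ M'.gr i)
    (hgr' : ∀ i, ∀ x ∈ M'.gr i, e.symm x ∈ M.gr i) (hsmul : ∀ (r : R) (x : M), e (r • x) = r • e x)
    (hd : ∀ x, e (M.d x) = M'.d (e x)) :
    ∃ i : M ≅ M', DGCategory.IsClosedZero K i.hom ∧ DGCategory.IsClosedZero K i.inv := by
  have closed : ∀ {M M' : DGMod.{w, u, v} R} (f : M →ₗ[K] M'),
      (∀ i, ∀ x ∈ M.gr i, f x ∈ M'.gr i) → (∀ (r : R) (x : M), f (r • x) = r • f x) →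
      (∀ x, f (M.d x) = M'.d (f x)) → ∃ g : M ⟶ M', g.1 = f ∧ DGCategory.IsClosedZero K g := by
    intro M M' f hgr hsmul hd
    have hf : f ∈ DGMod.homDeg M M' 0 :=
      ⟨fun i x hx => by
        rw [add_zero]
        exact hgr i x hx, fun i a _ x => by
        rw [zero_mul, Int.negOnePow_zero, one_smul, hsmul]⟩
    let g : M ⟶ M' := ⟨f, DGMod.homDeg_le _ _ _ hf⟩
    refine ⟨g, rfl, hf, DGMod.homTotal_ext fun x => ?_⟩
    refine (LinearMap.congr_fun (DGMod.homD_of_mem g hf) x).trans ?_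
    change M'.d (f x) - (0 : ℤ).negOnePow • f (M.d x) = 0
    rw [Int.negOnePow_zero, one_smul, hd, sub_self]
  obtain ⟨f, hf, hf'⟩ := closed e.toLinearMap hgr hsmul hd
  obtain ⟨g, hg, hg'⟩ := closed e.symm.toLinearMap hgr'
    (fun r x => by
      rw [LinearEquiv.coe_coe, LinearEquiv.symm_apply_eq, hsmul, LinearEquiv.apply_symm_apply])
    (fun x => by
      rw [LinearEquiv.coe_coe, LinearEquiv.symm_apply_eq, hd, LinearEquiv.apply_symm_apply])
  exact ⟨⟨f, g,
    DGMod.homTotal_ext fun x => by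
      rw [DGMod.comp_def, DGMod.id_def, hf, hg]
      exact e.symm_apply_apply x,
    DGMod.homTotal_ext fun x => by
      rw [DGMod.comp_def, DGMod.id_def, hf, hg]
      exact e.apply_symm_apply x⟩, hf', hg'⟩

namespace DGBimod.TriangularMatrixAlgebra

variable {K : Type w} [CommRing K] {U : DGAlg.{w, u₂} K} {T : DGAlg.{w, u₁} K}
  {N : DGBimod.{w, u₁, u₂, v} U T} {Λ : DGAlg.{w, u} K} (h : N.TriangularMatrixAlgebra Λ)

theorem symm_mul_symm (t t' : T) (m m' : N) (u u' : U) :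
    h.entries.symm (t, m, u) * h.entries.symm (t', m', u') =
      h.entries.symm (t * t', MulOpposite.op t' • m + u • m', u * u') := by
  rw [LinearEquiv.eq_symm_apply, h.entries_mul, LinearEquiv.apply_symm_apply,
    LinearEquiv.apply_symm_apply]

theorem symm_zero : h.entries.symm (0, 0, 0) = 0 := map_zero _

theorem d_symm (t : T) (m : N) (u : U) :
    Λ.d (h.entries.symm (t, m, u)) = h.entries.symm (T.d t, N.d m, U.d u) := by
  rw [LinearEquiv.eq_symm_apply, h.entries_d, LinearEquiv.apply_symm_apply]

/-- The upper left corner `T → Λ`. -/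
def upperCorner : T.CornerHom Λ where
  toFun := h.entries.symm.toLinearMap ∘ₗ LinearMap.inl K T (N × U)
  map_mul a b := by
    change h.entries.symm (a * b, 0, 0) = h.entries.symm (a, 0, 0) * h.entries.symm (b, 0, 0)
    rw [symm_mul_symm, smul_zero, smul_zero, add_zero, mul_zero]
  map_mem ha := h.mem_gr_of_entries ha (zero_mem _) (zero_mem _)
  map_d a := by
    change h.entries.symm (T.d a, 0, 0) = Λ.d (h.entries.symm (a, 0, 0))
    rw [d_symm, map_zero, map_zero]

/-- The lower right corner `U → Λ`. -/
def lowerCorner : U.CornerHom Λ where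
  toFun := h.entries.symm.toLinearMap ∘ₗ LinearMap.inr K T (N × U) ∘ₗ LinearMap.inr K N U
  map_mul a b := by
    change h.entries.symm (0, 0, a * b) = h.entries.symm (0, 0, a) * h.entries.symm (0, 0, b)
    rw [symm_mul_symm, smul_zero, smul_zero, add_zero, mul_zero]
  map_mem ha := h.mem_gr_of_entries (zero_mem _) (zero_mem _) ha
  map_d a := by
    change h.entries.symm (0, 0, U.d a) = Λ.d (h.entries.symm (0, 0, a))
    rw [d_symm, map_zero, map_zero]

variable (M : DGMod.{w, u, v} Λ)

theorem symm_smul_mem_fixedPoints (m : N) (x : M) :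
    h.entries.symm (0, m, 0) • x ∈ h.lowerCorner.fixedPoints M := by
  change h.entries.symm (0, 0, 1) • h.entries.symm (0, m, 0) • x = _
  rw [smul_smul, symm_mul_symm, smul_zero, zero_add, one_smul, mul_zero, mul_zero]

/-- The action of the lower left corner `N` of `Λ`, as a pairing between the two corners of a
dg-`Λ`-module. -/
def cornerPairing : N →ₗ[K] h.upperCorner.corner M →ₗ[K] h.lowerCorner.corner M :=
  LinearMap.mk₂ K
    (fun m (x : h.upperCorner.fixedPoints M) =>
      (⟨h.entries.symm (0, m, 0) • x.1, h.symm_smul_mem_fixedPoints M m x.1⟩ :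
        h.lowerCorner.fixedPoints M))
    (fun m m' x => Subtype.ext (by
      change h.entries.symm (0, m + m', 0) • x.1 =
        h.entries.symm (0, m, 0) • x.1 + h.entries.symm (0, m', 0) • x.1
      rw [← add_smul, ← map_add]
      simp))
    (fun k m x => Subtype.ext (by
      change h.entries.symm (0, k • m, 0) • x.1 = k • h.entries.symm (0, m, 0) • x.1
      rw [← smul_assoc, ← map_smul]
      simp))
    (fun m x y => Subtype.ext (smul_add _ _ _))
    (fun k m x => Subtype.ext (DGMod.smul_comm_K M k _ x.1))

theorem isDGPairing_cornerPairing : N.IsDGPairing (h.cornerPairing M) where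
  mem hm ha := M.smul_mem (h.mem_gr_of_entries (zero_mem _) hm (zero_mem _)) ha
  smul_left u m x := Subtype.ext (by
    change h.entries.symm (0, u • m, 0) • x.1 =
      h.entries.symm (0, 0, u) • h.entries.symm (0, m, 0) • x.1
    rw [smul_smul, symm_mul_symm, smul_zero, zero_add, mul_zero, mul_zero])
  balanced t m x := Subtype.ext (by
    change h.entries.symm (0, MulOpposite.op t • m, 0) • x.1 =
      h.entries.symm (0, m, 0) • h.entries.symm (t, 0, 0) • x.1
    rw [smul_smul, symm_mul_symm, smul_zero, add_zero, zero_mul, zero_mul])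
  d_apply {i m} hm x := Subtype.ext (by
    change M.d (h.entries.symm (0, m, 0) • x.1) = h.entries.symm (0, N.d m, 0) • x.1 +
      i.negOnePow • (h.entries.symm (0, m, 0) • M.d x.1)
    rw [M.d_smul (h.mem_gr_of_entries (zero_mem _) hm (zero_mem _)), d_symm, map_zero, map_zero])

/-- The decomposition `M = e₁ M ⊕ e₂ M` for the two diagonal idempotents of `Λ`. -/
def peirceEquiv :
    (h.upperCorner.fixedPoints M × h.lowerCorner.fixedPoints M) ≃ₗ[K] M where
  toFun p := p.1.1 + p.2.1
  map_add' p q := add_add_add_comm _ _ _ _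
  map_smul' k p := (smul_add k p.1.1 p.2.1).symm
  invFun x := (⟨h.entries.symm (1, 0, 0) • x, h.upperCorner.smul_mem_fixedPoints M 1 x⟩,
    ⟨h.entries.symm (0, 0, 1) • x, h.lowerCorner.smul_mem_fixedPoints M 1 x⟩)
  left_inv p := by
    have h₁ : h.entries.symm (1, 0, 0) • p.1.1 = p.1.1 := p.1.2
    have h₂ : h.entries.symm (0, 0, 1) • p.2.1 = p.2.1 := p.2.2
    refine Prod.ext (Subtype.ext ?_) (Subtype.ext ?_)
    · change h.entries.symm (1, 0, 0) • (p.1.1 + p.2.1) = p.1.1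
      rw [smul_add, h₁, ← h₂, smul_smul, symm_mul_symm]
      simp [h.symm_zero]
    · change h.entries.symm (0, 0, 1) • (p.1.1 + p.2.1) = p.2.1
      rw [smul_add, h₂, ← h₁, smul_smul, symm_mul_symm]
      simp [h.symm_zero]
  right_inv x := by
    change h.entries.symm (1, 0, 0) • x + h.entries.symm (0, 0, 1) • x = x
    rw [← add_smul, ← map_add, Prod.mk_add_mk, Prod.mk_add_mk, add_zero, add_zero, zero_add,
      ← h.entries_one, LinearEquiv.symm_apply_apply, one_smul]

/-- On `M = e₁ M ⊕ e₂ M`, a matrix `[[t, 0], [m, u]]` acts by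
`(a, b) ↦ (t a, m a + u b)`. -/
theorem symm_smul_add_symm_smul (r : Λ)
    (p : h.upperCorner.fixedPoints M × h.lowerCorner.fixedPoints M) :
    h.entries.symm ((h.entries r).1, 0, 0) • p.1.1 +
        (h.entries.symm (0, (h.entries r).2.1, 0) • p.1.1 +
          h.entries.symm (0, 0, (h.entries r).2.2) • p.2.1) = r • (p.1.1 + p.2.1) := by
  have h₁ : h.entries.symm (1, 0, 0) • p.1.1 = p.1.1 := p.1.2
  have h₂ : h.entries.symm (0, 0, 1) • p.2.1 = p.2.1 := p.2.2
  obtain ⟨⟨t, m, u⟩, rfl⟩ := h.entries.symm.surjective r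
  rw [LinearEquiv.apply_symm_apply, smul_add]
  rw [← add_assoc, ← add_smul, ← map_add]
  congr 1
  · rw [← h₁, smul_smul, smul_smul, symm_mul_symm, symm_mul_symm]
    simp
  · rw [← h₂, smul_smul, smul_smul, symm_mul_symm, symm_mul_symm]
    simp

theorem exists_columnFunctor_obj_iso :
    ∃ (X : DGComma K N.homFunctor) (i : h.columnFunctor.obj X ≅ M),
      DGCategory.IsClosedZero K i.hom ∧ DGCategory.IsClosedZero K i.inv := by
  obtain ⟨f, hf, hfP⟩ := (h.isDGPairing_cornerPairing M).exists_closed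
  let X : DGComma K N.homFunctor := ⟨_, _, f, hf⟩
  refine ⟨X, DGMod.exists_closedIso (M := h.columnObj X) (M' := M) (h.peirceEquiv M)
    (fun i p hp => add_mem (show p.1.1 ∈ M.gr i from hp.1) (show p.2.1 ∈ M.gr i from hp.2))
    (fun i x hx => ⟨h.upperCorner.one_smul_mem M hx, h.lowerCorner.one_smul_mem M hx⟩)
    (fun r p => ?_) (fun p => (map_add M.d p.1.1 p.2.1).symm)⟩
  refine Eq.trans ?_ (h.symm_smul_add_symm_smul M r p)
  change h.entries.symm ((h.entries r).1, 0, 0) • p.1.1 +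
    (N.pairing f (h.entries r).2.1 p.1 + (h.entries r).2.2 • p.2 : h.lowerCorner.corner M).1 = _
  rw [hfP]
  rfl

/-- The column functor is an equivalence of dg-categories. -/
theorem nonempty_dgEquivalence (h : N.TriangularMatrixAlgebra Λ) :
    Nonempty (DGEquivalence K (DGComma K N.homFunctor) (DGMod.{w, u, v} Λ)) :=
  DGEquivalence.nonempty_of_fullyFaithful h.columnFunctor
    (fun γ hγ => h.exists_columnFunctor_map_eq γ hγ) fun M => h.exists_columnFunctor_obj_iso M

end DGBimod.TriangularMatrixAlgebra

end

theorem mainTheorem3 {K : Type w} [CommRing K] (U : DGAlg.{w, u₂} K) (T : DGAlg.{w, u₁} K)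
    (N : DGBimod.{w, u₁, u₂, v} U T) :
    (∃ Λ : DGAlg.{w, max u₁ u₂ v} K, Nonempty (N.TriangularMatrixAlgebra Λ)) ∧
    ∀ Λ : DGAlg.{w, max u₁ u₂ v} K, N.TriangularMatrixAlgebra Λ →
      Nonempty (DGEquivalence K (DGComma K N.homFunctor) (DGMod.{w, max u₁ u₂ v, v} Λ)) :=
  ⟨⟨N.triangularDGAlg, N.nonempty_triangularMatrixAlgebra⟩,
    fun _ h => h.nonempty_dgEquivalence⟩
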